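/- Let $Q$ be a smooth $n$-manifold and let $\pi\colon T^1_kQ=TQ\oplus\overset{k}{\cdots}\oplus TQ\to Q$ be its $k$-tangent bundle, with points $(q;v_1,\dots,v_k)$. Let $J^\alpha_x(u)=(d\pi_x u)^{\wedge\alpha}_x$ be the vertical endomorphisms, where $(v)^{\wedge\alpha}_x$ is the vertical $\alpha$-lift, i.e. the velocity at $t=0$ of $t\mapsto(q;v_1,\dots,v_\alpha+tv,\dots,v_k)$, and let $\Delta_x=\sum_\alpha (v_\alpha)^{\wedge\alpha}_x$ be the Liouville vector field. For $\mathcal L\in C^\infty(T^1_kQ)$ put $\theta^\alpha_{\mathcal L}=d\mathcal L\circ J^\alpha$, $\omega^\alpha_{\mathcal L}=-d\theta^\alpha_{\mathcal L}$, $\mathcal E_{\mathcal L}=\Delta(\mathcal L)-\mathcal L$, and $\mathbf\Omega_{\mathcal L}(\mathbf X)=\sum_{\alpha}i(X_\alpha)\omega^\alpha_{\mathcal L}$ for $\mathbf X=(X_1,\dots,X_k)$. Let $\mathcal{FL}\colon T^1_kQ\to (T^1_k)^*Q=T^*Q\oplus\overset{k}{\cdots}\oplus T^*Q$ be the Legendre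 transformation, whose $\alpha$-th covector at $(q;v_1,\dots,v_k)$ is $u\mapsto\frac{d}{ds}\big|_{s=0}\mathcal L(q;v_1,\dots,v_\alpha+su,\dots,v_k)$. Assume that $\mathcal L$ is almost-regular: the image of $\mathcal{FL}$ is a closed submanifold, $\mathcal{FL}$ is a submersion onto its image, and the fibres of $\mathcal{FL}$ are connected submanifolds. A function $f$ is called $\mathcal{FL}$-projectable if $f=h\circ\mathcal{FL}$ for some function $h$, and $\mathcal{FL}$-projectable along a set $S$ if $f=h\circ\mathcal{FL}$ on $S$ for some $h$. A $k$-vector $\mathbf X$ at $x=(q;v_1,\dots,v_k)$ is SOPDE if $d\pi(X_\alpha)=v_\alpha$ for all $\alpha$. Let $P_1$ be the set of points at which the Lagrangian equation $\mathbf\Omega_{\mathcal L}(\mathbf X)=d\mathcal E_{\mathcal L}$ has a solution, and let $S_1\subseteq P_1$ be the set of points at which some solution of it becomes SOPDE after adding an element of $\operatorname{Ker}\mathbf\Omega_{\mathcal L}$. Let $\operatorname{Ker}^V\mathbf\Omega_{\mathcal L}$ be the set of $\pi$-vertical elements of $\operatorname{Ker}\mathbf\Omega_{\mathcal L}$. Let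 $\mathbf X,\mathbf Y,\mathbf V$ be smooth $k$-vector fields on $T^1_kQ$ such that $\mathbf X$ solves the Lagrangian equation on $P_1$, such that $\mathbf Y\in\operatorname{Ker}\mathbf\Omega_{\mathcal L}$ and $\mathbf V\in\operatorname{Ker}^V\mathbf\Omega_{\mathcal L}$ on $S_1$, and such that $\mathbf X+\mathbf Y+\mathbf V$ is SOPDE on $S_1$. Let $Z_1,\dots,Z_k$ be smooth vector fields in $[\mathfrak X^k(T^1_kQ)]^\perp=\{Z \mid \mathbf\Omega_{\mathcal L}(\mathbf W)(Z)=0\text{ for every smooth }k\text{-vector field }\mathbf W\}$ whose first generation dynamical constraints $\zeta_1^{(Z_\alpha)}=i(Z_\alpha)d\mathcal E_{\mathcal L}$ are $\mathcal{FL}$-projectable, and consider $$\eta_2^{(Z)}=\sum_{\alpha=1}^k (X_\alpha+Y_\alpha+V_\alpha)\big(\zeta_1^{(Z_\alpha)}\big).$$ (Taking all the $Z_\beta$ but one equal to $0$ gives the function $(X_\alpha+Y_\alpha+V_\alpha)(\zeta_1^{(Z)})$ for a single index $\alpha$ and a single $Z$.) Suppose that $\eta_2^{(Z)}$ is a second generation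 SOPDE constraint at some point $x_0\in S_1$, that is: 1. at $x_0$ the tangency condition $\eta_2^{(Z)}=0$ does not restrict the choice of $\mathbf V$: $\sum_\alpha U_\alpha(\zeta_1^{(Z_\alpha)})(x_0)=0$ for every $\mathbf U\in(\operatorname{Ker}^V\mathbf\Omega_{\mathcal L})_{x_0}$; 2. at $x_0$ the SOPDE part contributes to it: $\sum_\alpha Y_\alpha(\zeta_1^{(Z_\alpha)})(x_0)\neq0$. Then $\eta_2^{(Z)}$ is not $\mathcal{FL}$-projectable; it is not even $\mathcal{FL}$-projectable along $S_1$. -/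

import Mathlib

open scoped Manifold ContDiff Bundle

noncomputable section

namespace KSymplectic

/-- The model vector space `ℝⁿ` of the base manifold `Q`. -/
abbrev Base (n : ℕ) : Type := EuclideanSpace ℝ (Fin n)

/-- The model fibre of `T¹ₖQ`: a `k`-tuple `(v₁, …, vₖ)` of vectors of `ℝⁿ` is encoded as the
linear map `ℝᵏ → ℝⁿ`, `c ↦ ∑ c_α v_α`. -/
abbrev VelFibre (k n : ℕ) : Type := (Fin k → ℝ) →L[ℝ] Base n

/-- The model fibre of `(T¹ₖ)*Q`: a `k`-tuple `(p¹, …, pᵏ)` of covectors is encoded as the linear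
map `ℝⁿ → ℝᵏ`, `u ↦ (p¹ u, …, pᵏ u)`. -/
abbrev MomFibre (k n : ℕ) : Type := Base n →L[ℝ] (Fin k → ℝ)

/-- Slice charts. `S` is, in the chart `e` around `p`, an affine subspace with direction `F`. -/
def IsSliceChart {E H M : Type*} [NormedAddCommGroup E] [NormedSpace ℝ E] [TopologicalSpace H]
    (I : ModelWithCorners ℝ E H) [TopologicalSpace M] [ChartedSpace H M]
    (S : Set M) (p : M) (e : OpenPartialHomeomorph M H) (F : Submodule ℝ E) : Prop :=
  e ∈ IsManifold.maximalAtlas I ∞ M ∧ p ∈ e.source ∧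
    ∀ y ∈ e.source, (y ∈ S ↔ e.extend I y - e.extend I p ∈ F)

/-- `S` is an (embedded, smooth) submanifold. -/
def IsSubmanifold {E H M : Type*} [NormedAddCommGroup E] [NormedSpace ℝ E] [TopologicalSpace H]
    (I : ModelWithCorners ℝ E H) [TopologicalSpace M] [ChartedSpace H M] (S : Set M) : Prop :=
  ∀ p ∈ S, ∃ (e : OpenPartialHomeomorph M H) (F : Submodule ℝ E), IsSliceChart I S p e F

/-- The exterior derivative of a `1`-form `θ`: at `x` it is
`dθ (u, w) = D_u (θ w) - D_w (θ u)`, computed in the preferred chart at `x` with `u`, `w` extended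
to constant vector fields of the chart (tangent vectors at `x` are by definition represented
in that chart). -/
def extDerivOneForm {E H M : Type*} [NormedAddCommGroup E] [NormedSpace ℝ E] [TopologicalSpace H]
    (I : ModelWithCorners ℝ E H) [TopologicalSpace M] [ChartedSpace H M]
    (θ : ∀ x : M, TangentSpace I x →L[ℝ] ℝ) (x : M) (u w : TangentSpace I x) : ℝ :=
  let φ := extChartAt I x
  let θloc : E → (E →L[ℝ] ℝ) := fun y =>
    (θ (φ.symm y)).comp (mfderivWithin 𝓘(ℝ, E) I φ.symm (Set.range I) y)
  let dθloc : E → E → ℝ := fun a b => fderivWithin ℝ θloc (Set.range I) (φ x) a b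
  dθloc u w - dθloc w u

section

variable (k n : ℕ) (Q : Type*) [TopologicalSpace Q] [ChartedSpace (EuclideanSpace ℝ (Fin n)) Q]
  [IsManifold (𝓡 n) ∞ Q]

/-- The `k`-tangent bundle `T¹ₖQ = TQ ⊕ ⋯ ⊕ TQ`, as the bundle `Hom(ℝᵏ, TQ)`. -/
abbrev KTangent : Type _ :=
  Bundle.TotalSpace (VelFibre k n)
    (fun q : Q => Bundle.Trivial Q (Fin k → ℝ) q →L[ℝ] TangentSpace (𝓡 n) q)

/-- The `k`-cotangent bundle `(T¹ₖ)*Q = T*Q ⊕ ⋯ ⊕ T*Q`, as the bundle `Hom(TQ, ℝᵏ)`. -/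
abbrev KCotangent : Type _ :=
  Bundle.TotalSpace (MomFibre k n)
    (fun q : Q => TangentSpace (𝓡 n) q →L[ℝ] Bundle.Trivial Q (Fin k → ℝ) q)

/-- The model with corners of the manifold `T¹ₖQ`. -/
abbrev modelT : ModelWithCorners ℝ (Base n × VelFibre k n) (ModelProd (Base n) (VelFibre k n)) :=
  (𝓡 n).prod 𝓘(ℝ, VelFibre k n)

/-- The model with corners of the manifold `(T¹ₖ)*Q`. -/
abbrev modelC : ModelWithCorners ℝ (Base n × MomFibre k n) (ModelProd (Base n) (MomFibre k n)) :=
  (𝓡 n).prod 𝓘(ℝ, MomFibre k n)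

end

variable {k n : ℕ} {Q : Type*} [TopologicalSpace Q] [ChartedSpace (EuclideanSpace ℝ (Fin n)) Q]
  [IsManifold (𝓡 n) ∞ Q]

/-- The tangent space of `T¹ₖQ` at `x`. -/
abbrev Tan (x : KTangent k n Q) : Type := TangentSpace (modelT k n) x

/-! ### Geometry of the `k`-tangent bundle -/

/-- The velocity `v_α` of the point `x = (q; v₁, …, vₖ)`. -/
def velocity (x : KTangent k n Q) (α : Fin k) : TangentSpace (𝓡 n) x.proj :=
  x.2 (Pi.single α 1 : Fin k → ℝ)

/-- The differential at `x` of the projection `π : T¹ₖQ → Q`. -/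
def dproj (x : KTangent k n Q) : Tan x →L[ℝ] TangentSpace (𝓡 n) x.proj :=
  mfderiv (modelT k n) (𝓡 n) (fun y : KTangent k n Q => y.proj) x

/-- The differential at `x = (q; v)` of the inclusion of the fibre of `T¹ₖQ` over `q`. -/
def fibreLift (x : KTangent k n Q) : VelFibre k n →L[ℝ] Tan x :=
  mfderiv 𝓘(ℝ, VelFibre k n) (modelT k n)
    (fun w : VelFibre k n => (⟨x.proj, w⟩ : KTangent k n Q)) x.2

/-- The vertical `α`-lift `(v)^{∧α}_x`, the velocity at `t = 0` of the curve
`t ↦ (q; v₁, …, v_α + t v, …, vₖ)`, as a linear function of `v ∈ T_qQ`. -/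
def verticalLift (α : Fin k) (x : KTangent k n Q) : TangentSpace (𝓡 n) x.proj →L[ℝ] Tan x :=
  (fibreLift x).comp
    (ContinuousLinearMap.smulRightL ℝ (Fin k → ℝ) (Base n)
      (ContinuousLinearMap.proj α : (Fin k → ℝ) →L[ℝ] ℝ) : Base n →L[ℝ] VelFibre k n)

/-- The vertical endomorphism `J^α`. -/
def vertEndo (α : Fin k) (x : KTangent k n Q) : Tan x →L[ℝ] Tan x :=
  (verticalLift α x).comp (dproj x)

/-- The Liouville vector field `Δ = ∑_α (v_α)^{∧α}`. -/
def liouville (x : KTangent k n Q) : Tan x :=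
  ∑ α : Fin k, verticalLift α x (velocity x α)

/-- The differential of a function on `T¹ₖQ`. -/
def dfun (f : KTangent k n Q → ℝ) (x : KTangent k n Q) : Tan x →L[ℝ] ℝ :=
  mfderiv (modelT k n) 𝓘(ℝ, ℝ) f x

/-! ### Lagrangian objects -/

/-- The Cartan `1`-form `θ^α_L = dL ∘ J^α`. -/
def cartanOne (L : KTangent k n Q → ℝ) (α : Fin k) (x : KTangent k n Q) : Tan x →L[ℝ] ℝ :=
  (dfun L x).comp (vertEndo α x)

/-- The Cartan `2`-form `ω^α_L = -dθ^α_L`. -/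
def cartanTwo (L : KTangent k n Q → ℝ) (α : Fin k) (x : KTangent k n Q) (u w : Tan x) : ℝ :=
  -extDerivOneForm (modelT k n) (cartanOne L α) x u w

/-- The Lagrangian energy `E_L = Δ(L) - L`. -/
def energy (L : KTangent k n Q → ℝ) (x : KTangent k n Q) : ℝ :=
  dfun L x (liouville x) - L x

/-- `Ω_L(X) = ∑_α i(X_α) ω^α_L` at `x`, for a `k`-vector `X = (X₁, …, Xₖ)` at `x`. -/
def bigOmega (L : KTangent k n Q → ℝ) (x : KTangent k n Q) (X : Fin k → Tan x) (w : Tan x) : ℝ :=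
  ∑ α : Fin k, cartanTwo L α x (X α) w

/-- The Legendre transformation: the `α`-th covector of `FL(q; v)` sends `u ∈ T_qQ` to
`d/ds L(q; v₁, …, v_α + s u, …, vₖ)` at `s = 0`, that is, to `dL ((u)^{∧α})`. -/
def legendre (L : KTangent k n Q → ℝ) (x : KTangent k n Q) : KCotangent k n Q :=
  ⟨x.proj, (ContinuousLinearMap.pi fun α => (dfun L x).comp (verticalLift α x) :
    TangentSpace (𝓡 n) x.proj →L[ℝ] (Fin k → ℝ))⟩

/-- Almost-regular Lagrangians: the image of `FL` is a closed submanifold, `FL` is a submersion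
onto it (its differential at `x` maps onto the tangent space of the image, which is the direction
`F` in a slice chart), and the fibres of `FL` are connected submanifolds. -/
structure IsAlmostRegular (L : KTangent k n Q → ℝ) : Prop where
  smooth : ContMDiff (modelT k n) 𝓘(ℝ, ℝ) ∞ L
  image_closed : IsClosed (Set.range (legendre L))
  image_submanifold : IsSubmanifold (modelC k n) (Set.range (legendre L))
  submersion : ∀ (x : KTangent k n Q)
    (e : OpenPartialHomeomorph (KCotangent k n Q) (ModelProd (Base n) (MomFibre k n)))
    (F : Submodule ℝ (Base n × MomFibre k n)),
    IsSliceChart (modelC k n) (Set.range (legendre L)) (legendre L x) e F →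
    Set.range (mfderiv (modelT k n) 𝓘(ℝ, Base n × MomFibre k n)
      (fun y => e.extend (modelC k n) (legendre L y)) x) = (F : Set (Base n × MomFibre k n))
  fibre_connected : ∀ p ∈ Set.range (legendre L), IsConnected (legendre L ⁻¹' {p})
  fibre_submanifold : ∀ p ∈ Set.range (legendre L),
    IsSubmanifold (modelT k n) (legendre L ⁻¹' {p})

/-- `f` is `FL`-projectable along `S`: on `S` it is the pull-back by `FL` of a function. -/
def IsFLProjectableOn (L : KTangent k n Q → ℝ) (S : Set (KTangent k n Q))
    (f : KTangent k n Q → ℝ) : Prop :=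
  ∃ h : KCotangent k n Q → ℝ, ∀ x ∈ S, f x = h (legendre L x)

/-- `f` is `FL`-projectable. -/
def IsFLProjectable (L : KTangent k n Q → ℝ) (f : KTangent k n Q → ℝ) : Prop :=
  IsFLProjectableOn L Set.univ f

/-! ### Vector fields, `k`-vector fields and the first constraint sets -/

/-- Smooth vector fields on `T¹ₖQ`. -/
def IsSmoothVF (Z : ∀ x : KTangent k n Q, Tan x) : Prop :=
  ContMDiff (modelT k n) (modelT k n).tangent ∞
    (fun x => (⟨x, Z x⟩ : TangentBundle (modelT k n) (KTangent k n Q)))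

/-- Smooth `k`-vector fields on `T¹ₖQ`. -/
def IsSmoothKVF (X : ∀ x : KTangent k n Q, Fin k → Tan x) : Prop :=
  ∀ α, IsSmoothVF fun x => X x α

/-- The `k`-vector `X` at `x` solves the Lagrangian equation `∑_α i(X_α) ω^α_L = dE_L` at `x`. -/
def SolvesLagrangian (L : KTangent k n Q → ℝ) (x : KTangent k n Q) (X : Fin k → Tan x) : Prop :=
  ∀ w : Tan x, bigOmega L x X w = dfun (energy L) x w

/-- The `k`-vector `X` at `x` belongs to `Ker Ω_L`. -/
def InKerOmega (L : KTangent k n Q → ℝ) (x : KTangent k n Q) (X : Fin k → Tan x) : Prop :=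
  ∀ w : Tan x, bigOmega L x X w = 0

/-- The `k`-vector `X` at `x` belongs to `Ker^V Ω_L`: it is `π`-vertical and in `Ker Ω_L`. -/
def InVertKerOmega (L : KTangent k n Q → ℝ) (x : KTangent k n Q) (X : Fin k → Tan x) : Prop :=
  InKerOmega L x X ∧ ∀ α, dproj x (X α) = 0

/-- The `k`-vector `X` at `x` satisfies the second-order (SOPDE) condition `T¹ₖπ (X) = x`. -/
def IsSopdeAt (x : KTangent k n Q) (X : Fin k → Tan x) : Prop :=
  ∀ α, dproj x (X α) = velocity x α

/-- `P₁`: the points where the Lagrangian equation has a solution. -/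
def P1 (L : KTangent k n Q → ℝ) : Set (KTangent k n Q) :=
  {x | ∃ X : Fin k → Tan x, SolvesLagrangian L x X}

/-- `S₁`: the points of `P₁` where a solution of the Lagrangian equation becomes SOPDE after
adding an element of `Ker Ω_L`. -/
def S1 (L : KTangent k n Q → ℝ) : Set (KTangent k n Q) :=
  {x | ∃ X : Fin k → Tan x, SolvesLagrangian L x X ∧
    ∃ Y : Fin k → Tan x, InKerOmega L x Y ∧ IsSopdeAt x (X + Y)}

/-- `[𝔛ᵏ(T¹ₖQ)]^⊥`: the vector fields annihilated by every `Ω_L(Y)`. -/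
def InAnnihilator (L : KTangent k n Q → ℝ) (Z : ∀ x : KTangent k n Q, Tan x) : Prop :=
  IsSmoothVF Z ∧ ∀ Y : (∀ x : KTangent k n Q, Fin k → Tan x), IsSmoothKVF Y →
    ∀ x, bigOmega L x (Y x) (Z x) = 0

/-- The first generation dynamical constraint `ζ₁^{(Z)} = i(Z) dE_L`. -/
def zeta1 (L : KTangent k n Q → ℝ) (Z : ∀ x : KTangent k n Q, Tan x) (x : KTangent k n Q) : ℝ :=
  dfun (energy L) x (Z x)

/-- `∑_α W_α (ζ₁^{(Z_α)})` at `x`, for a `k`-vector `W` at `x`. If all the `Z_α` but one vanish,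
this is the derivative `W_α (ζ₁^{(Z)})` of one constraint along one component of `W`. -/
def tangency (L : KTangent k n Q → ℝ) (Z : Fin k → ∀ x : KTangent k n Q, Tan x)
    (x : KTangent k n Q) (W : Fin k → Tan x) : ℝ :=
  ∑ α : Fin k, dfun (zeta1 L (Z α)) x (W α)

/-- The second generation SOPDE constraint function
`η₂^{(Z)} = ∑_α (X_α + Y_α + V_α)(ζ₁^{(Z_α)})`. -/
def eta2 (L : KTangent k n Q → ℝ) (X Y V : ∀ x : KTangent k n Q, Fin k → Tan x)
    (Z : Fin k → ∀ x : KTangent k n Q, Tan x) (x : KTangent k n Q) : ℝ :=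
  tangency L Z x (X x + Y x + V x)

end KSymplectic

end

noncomputable section

namespace KSymplectic

open Filter Topology

set_option linter.unusedSectionVars false

/-! ### Maps of constant rank on normed spaces -/

/-! The idea is to exhibit two points of `S1 L` in one fibre of the Legendre map FL at which η₂
takes different values. Write x₀ = (q; v), and let a be the k-tuple of base components of Y at x₀.

The vertical vector (0, a) lies in ker d(FL): testing Ω(Y) = 0 on vertical vectors says that the
vertical Hessian of L kills a (`fderiv_legLoc_of_omegaLoc_eq_zero`). At every point of an FL-fibre
the range of d(FL) is the same, namely the tangent space of the image. By symmetry of the Hessian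
this range determines the kernel (`fderiv_legLoc_eq_zero_of_range`), so the kernel is constant along
the fibre near x₀ and the fibre is locally affine. Hence x_t = (q; v + t a) stays in the fibre for
small t (`eventually_fibre_of_ker`).

Call tangent vectors at x₀ and x_t matched when d(FL) sends them to the same vector. Each vector at
one point has a match at the other, and matching preserves everything relevant: base components; Ω,
which is a pull-back by FL (`omegaLoc_congr`); the differential of the energy
(`fderiv_energyLoc_eq`); and the differentials of projectable functions, with no regularity required
of the projected function (`fderiv_eq_of_factors`). These facts are assembled in
`eventually_legLoc_fibre` and moved to the manifold by `eventually_legendre_fibre`.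

Put W₀ = X + Y + V at x₀. Then W₀ + tY solves the Lagrangian equation with base components v + t a,
which are the velocities of x_t. Its match at x_t is therefore a SOPDE solution, and x_t ∈ `S1 L`.
Conversely let W' match X + Y + V at x_t. The difference W' - (W₀ + tY) is vertical and in Ker Ω, so
by the first constraint hypothesis it does not contribute to the tangency sum. Since the ζ₁ are
projectable, η₂(x_t) = η₂(x₀) + t ∑ Y_α(ζ₁)(x₀), and the last sum is nonzero by the second
hypothesis. -/

theorem tendsto_add_smul {N : Type*} [NormedAddCommGroup N] [NormedSpace ℝ N] (x v : N) :
    Tendsto (fun t : ℝ => x + t • v) (𝓝 0) (𝓝 x) := by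
  have h : Continuous fun t : ℝ => x + t • v := by fun_prop
  simpa using h.tendsto 0

section ConstantRank

variable {N E : Type*} [NormedAddCommGroup N] [NormedSpace ℝ N] [FiniteDimensional ℝ N]
  [NormedAddCommGroup E] [NormedSpace ℝ E] [FiniteDimensional ℝ E]

/-- A linear map between finite-dimensional spaces has a generalized inverse. -/
theorem exists_generalized_inverse (D : N →L[ℝ] E) :
    ∃ R : E →L[ℝ] N, ∀ w, D (R (D w)) = D w := by
  obtain ⟨r, hr⟩ := (D : N →ₗ[ℝ] E).rangeRestrict.exists_rightInverse_of_surjective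
    (LinearMap.range_rangeRestrict _)
  obtain ⟨R, hR⟩ := LinearMap.exists_extend r
  refine ⟨LinearMap.toContinuousLinearMap R, fun w => ?_⟩
  have h1 : R (D w) = r ((D : N →ₗ[ℝ] E).rangeRestrict w) := by
    rw [← hR]; rfl
  have h2 := LinearMap.congr_fun hr ((D : N →ₗ[ℝ] E).rangeRestrict w)
  have h3 := congrArg Subtype.val h2
  simpa [h1] using h3

/-- A map whose increments from `x` lie in the range of its derivative `D` at `x` is, up to a
local diffeomorphism `σ` tangent to a translation, equal to its linearization. -/
theorem exists_straightening {G : N → E} {x : N} (hG : ContDiffAt ℝ 1 G x)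
    (hrange : ∀ᶠ y in 𝓝 x, ∃ w, G y - G x = fderiv ℝ G x w) :
    ∃ σ : N → N, ContDiffAt ℝ 1 σ 0 ∧ σ 0 = x ∧ HasFDerivAt σ (ContinuousLinearMap.id ℝ N) 0 ∧
      (∀ᶠ u in 𝓝 0, G (σ u) = G x + fderiv ℝ G x u) ∧
      ∀ᶠ u in 𝓝 0, fderiv ℝ G x u = 0 → fderiv ℝ G x (σ u - x) = 0 → σ u = x + u := by
  obtain ⟨R, hR⟩ := exists_generalized_inverse (fderiv ℝ G x)
  set D := fderiv ℝ G x with hD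
  -- H replaces the part of y - x seen by D with the actual increment of G. Its derivative at x is
  -- RD + (id - RD) = id, and DRD = D gives D ∘ H = G - G x wherever the increments lie in the range
  -- of D. The local inverse of H is σ.
  let H : N → N := fun y => R (G y - G x) + ((y - x) - R (D (y - x)))
  have hH0 : H x = 0 := by simp [H]
  have hHc : ContDiffAt ℝ 1 H x := by
    refine (R.contDiff.contDiffAt.comp x (hG.sub contDiffAt_const)).add
      ((contDiffAt_id.sub contDiffAt_const).sub ?_)
    exact (R.contDiff.comp (D.contDiff.comp (contDiff_id.sub contDiff_const))).contDiffAt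
  have hG' : HasFDerivAt G D x := (hG.differentiableAt one_ne_zero).hasFDerivAt
  have hH' : HasFDerivAt H ((ContinuousLinearEquiv.refl ℝ N : N ≃L[ℝ] N) : N →L[ℝ] N) x := by
    have h1 : HasFDerivAt (fun y : N => y - x) (ContinuousLinearMap.id ℝ N) x :=
      (hasFDerivAt_id x).sub_const x
    have h2 : HasFDerivAt H (R.comp D + (ContinuousLinearMap.id ℝ N -
        R.comp (D.comp (ContinuousLinearMap.id ℝ N)))) x :=
      (R.hasFDerivAt.comp x (hG'.sub_const (G x))).add
        (h1.sub (R.hasFDerivAt.comp x (D.hasFDerivAt.comp x h1)))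
    refine h2.congr_fderiv ?_
    ext w
    simp
  let e := hHc.toOpenPartialHomeomorph H hH' one_ne_zero
  have hxe : x ∈ e.source := hHc.mem_toOpenPartialHomeomorph_source hH' one_ne_zero
  have h0e : (0 : N) ∈ e.target := by
    rw [← hH0]; exact hHc.image_mem_toOpenPartialHomeomorph_target hH' one_ne_zero
  have he : ∀ y, e y = H y := fun _ => rfl
  have hσ0 : e.symm 0 = x := by rw [← hH0, ← he, e.left_inv hxe]
  have hσt : ∀ᶠ u in 𝓝 (0 : N), H (e.symm u) = u := by
    filter_upwards [e.open_target.mem_nhds h0e] with u hu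
    exact e.right_inv hu
  have hσc : ContinuousAt e.symm 0 := e.continuousAt_symm h0e
  have hσr : ∀ᶠ u in 𝓝 (0 : N), ∃ w, G (e.symm u) - G x = D w := by
    have := hσc.tendsto
    rw [hσ0] at this
    exact this.eventually hrange
  have hkey : ∀ᶠ u in 𝓝 (0 : N), G (e.symm u) = G x + D u := by
    filter_upwards [hσt, hσr] with u hu ⟨w, hw⟩
    have h1 : D (H (e.symm u)) = D w := by
      simp only [H, hw]
      rw [map_add, map_sub D, hR, hR, sub_self, add_zero]
    rw [hu] at h1
    rw [h1, ← hw]; abel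
  refine ⟨e.symm, ?_, hσ0, ?_, hkey, ?_⟩
  · refine e.contDiffAt_symm h0e (f₀' := ContinuousLinearEquiv.refl ℝ N) ?_ ?_
    · rw [hσ0]; exact hH'
    · rw [hσ0]; exact hHc
  · have := e.hasFDerivAt_symm (f' := ContinuousLinearEquiv.refl ℝ N) h0e
      (by rw [hσ0]; exact hH')
    exact this
  · filter_upwards [hσt, hkey] with u hu hGu hDu hDσ
    have h1 : H (e.symm u) = e.symm u - x := by
      simp only [H, hGu, hDu, hDσ]
      simp
    rw [hu] at h1
    exact (sub_eq_iff_eq_add'.1 h1.symm)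

/-- Every tangent vector at `x` is the velocity of a curve along which `G` is affine. -/
theorem exists_curve_affine {G : N → E} {x : N} (hG : ContDiffAt ℝ 1 G x)
    (hrange : ∀ᶠ y in 𝓝 x, ∃ w, G y - G x = fderiv ℝ G x w) (w : N) :
    ∃ γ : ℝ → N, γ 0 = x ∧ HasDerivAt γ w 0 ∧
      ∀ᶠ s in 𝓝 (0 : ℝ), G (γ s) = G x + s • fderiv ℝ G x w := by
  obtain ⟨σ, -, hσ0, hσ', hσG, -⟩ := exists_straightening hG hrange
  have hl : HasDerivAt (fun s : ℝ => s • w) w 0 := by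
    simpa using (hasDerivAt_id (0 : ℝ)).smul_const w
  refine ⟨fun s => σ (s • w), by simp [hσ0], ?_, ?_⟩
  · have h : HasFDerivAt σ (ContinuousLinearMap.id ℝ N) ((0 : ℝ) • w) := by simpa using hσ'
    exact h.comp_hasDerivAt (0 : ℝ) hl
  · have ht : Tendsto (fun s : ℝ => s • w) (𝓝 0) (𝓝 0) := by
      simpa using hl.continuousAt.tendsto
    filter_upwards [ht.eventually hσG] with s hs
    rw [hs, map_smul]

/-- If two functions factor, near two points with the same image, through `G` by the same function,
their differentials at these points agree on vectors with the same image. -/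

theorem fderiv_eq_of_factors {G : N → E} {f : N → ℝ} {h : E → ℝ} {x y : N}
    (hGx : ContDiffAt ℝ 1 G x) (hGy : ContDiffAt ℝ 1 G y)
    (hrx : ∀ᶠ z in 𝓝 x, ∃ w, G z - G x = fderiv ℝ G x w)
    (hry : ∀ᶠ z in 𝓝 y, ∃ w, G z - G y = fderiv ℝ G y w)
    (hxy : G x = G y) (hfx : DifferentiableAt ℝ f x) (hfy : DifferentiableAt ℝ f y)
    (hhx : ∀ᶠ z in 𝓝 x, f z = h (G z)) (hhy : ∀ᶠ z in 𝓝 y, f z = h (G z))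
    {u w : N} (huw : fderiv ℝ G x u = fderiv ℝ G y w) :
    fderiv ℝ f x u = fderiv ℝ f y w := by
  obtain ⟨γ, hγ0, hγ', hγG⟩ := exists_curve_affine hGx hrx u
  obtain ⟨δ, hδ0, hδ', hδG⟩ := exists_curve_affine hGy hry w
  have h1 : HasDerivAt (f ∘ γ) (fderiv ℝ f x u) 0 :=
    HasFDerivAt.comp_hasDerivAt (0 : ℝ) (by rw [hγ0]; exact hfx.hasFDerivAt) hγ'
  have h2 : HasDerivAt (f ∘ δ) (fderiv ℝ f y w) 0 :=
    HasFDerivAt.comp_hasDerivAt (0 : ℝ) (by rw [hδ0]; exact hfy.hasFDerivAt) hδ'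
  -- G takes equal values along the two curves, hence so does f, whatever h is: neither continuity
  -- nor differentiability of h enters.
  refine h1.unique (h2.congr_of_eventuallyEq ?_)
  have tγ := hγ'.continuousAt.tendsto
  have tδ := hδ'.continuousAt.tendsto
  rw [hγ0] at tγ
  rw [hδ0] at tδ
  filter_upwards [hγG, hδG, tγ.eventually hhx, tδ.eventually hhy] with s a b c d
  simp only [Function.comp_apply, c, d, a, b, hxy, huw]

/-- If the kernel of the derivative does not grow along the fibre of `G` through `x`, this fibre
contains, near `x`, the affine space `x + ker`. -/
theorem eventually_fibre_of_ker {G : N → E} {x : N} (hG : ContDiffAt ℝ 1 G x)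
    (hrange : ∀ᶠ y in 𝓝 x, ∃ w, G y - G x = fderiv ℝ G x w)
    (hker : ∀ᶠ y in 𝓝 x, G y = G x → ∀ w, fderiv ℝ G y w = 0 → fderiv ℝ G x w = 0)
    {z : N} (hz : fderiv ℝ G x z = 0) :
    ∀ᶠ s in 𝓝 (0 : ℝ), G (x + s • z) = G x := by
  obtain ⟨σ, hσc, hσ0, -, hσG, hσK⟩ := exists_straightening hG hrange
  set D := fderiv ℝ G x with hD
  have ht : Tendsto (fun s : ℝ => s • z) (𝓝 0) (𝓝 0) := by
    have : Continuous fun s : ℝ => s • z := by fun_prop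
    simpa using this.tendsto 0
  have tσ : Tendsto σ (𝓝 0) (𝓝 x) := by
    have := hσc.continuousAt.tendsto
    rwa [hσ0] at this
  have hσd : ∀ᶠ u in 𝓝 (0 : N), DifferentiableAt ℝ σ u :=
    (hσc.eventually (by simp)).mono fun u hu => hu.differentiableAt one_ne_zero
  have hGd : ∀ᶠ y in 𝓝 x, DifferentiableAt ℝ G y :=
    (hG.eventually (by simp)).mono fun u hu => hu.differentiableAt one_ne_zero
  have hDz : ∀ s : ℝ, D (s • z) = 0 := fun s => by rw [map_smul, hz, smul_zero]
  have hcst : ∀ᶠ s in 𝓝 (0 : ℝ), G (σ (s • z)) = G x := by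
    filter_upwards [ht.eventually hσG] with s hs
    rw [hs, hDz, add_zero]
  -- The curve s ↦ σ (s • z) runs inside the fibre, so its velocity is in the kernel of the
  -- derivative of G at the current point, hence in ker D. Thus D (σ (s • z) - x) is constantly 0,
  -- and the last clause of the straightening identifies σ (s • z) with x + s • z.
  have hder : ∀ᶠ s in 𝓝 (0 : ℝ), HasDerivAt (fun s : ℝ => D (σ (s • z) - x)) 0 s := by
    filter_upwards [hcst.eventually_nhds, ht.eventually hσd, ht.eventually (tσ.eventually hGd),
      ht.eventually (tσ.eventually hker)] with s h1 h2 h3 h4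
    have hl : HasDerivAt (fun s : ℝ => s • z) z s := by
      simpa using (hasDerivAt_id s).smul_const z
    have hσs : HasDerivAt (fun s : ℝ => σ (s • z)) (fderiv ℝ σ (s • z) z) s :=
      h2.hasFDerivAt.comp_hasDerivAt s hl
    have hGs : HasDerivAt (fun s : ℝ => G (σ (s • z)))
        (fderiv ℝ G (σ (s • z)) (fderiv ℝ σ (s • z) z)) s :=
      h3.hasFDerivAt.comp_hasDerivAt s hσs
    have h0 : fderiv ℝ G (σ (s • z)) (fderiv ℝ σ (s • z) z) = 0 :=
      hGs.unique ((hasDerivAt_const s (G x)).congr_of_eventuallyEq h1)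
    have h5 := h4 h1.self_of_nhds _ h0
    have h6 := D.hasFDerivAt.comp_hasDerivAt s (hσs.sub_const x)
    rw [h5] at h6
    exact h6
  obtain ⟨ε, hε, hball⟩ := Metric.eventually_nhds_iff_ball.1 hder
  have hzero : ∀ s ∈ Metric.ball (0 : ℝ) ε, D (σ (s • z) - x) = 0 := by
    intro s hs
    have := (convex_ball (0 : ℝ) ε).is_const_of_fderivWithin_eq_zero (𝕜 := ℝ)
      (f := fun s : ℝ => D (σ (s • z) - x))
      (fun r hr => (hball r hr).differentiableAt.differentiableWithinAt)
      (fun r hr => by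
        rw [fderivWithin_of_isOpen Metric.isOpen_ball hr]
        rw [(hball r hr).hasFDerivAt.fderiv]
        simp) hs (Metric.mem_ball_self hε)
    rw [this]; simp [hσ0]
  filter_upwards [ht.eventually hσK, Metric.ball_mem_nhds (0 : ℝ) hε, hcst] with s h1 h2 h3
  rw [← h1 (hDz s) (hzero s h2), h3]

end ConstantRank

/-! ### Lagrangians in coordinates -/

section Coordinates

variable {k : ℕ} {B V : Type*} [NormedAddCommGroup B] [NormedSpace ℝ B] [FiniteDimensional ℝ B]
  [NormedAddCommGroup V] [NormedSpace ℝ V] [FiniteDimensional ℝ V]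

/-- The `k`-covector obtained by restricting a covector to `k` slots `sₐ : B → V` of the
fibre, as a linear map. -/
def fibreCovectorLin (s : Fin k → B →L[ℝ] V) :
    (B × V →L[ℝ] ℝ) →ₗ[ℝ] (B →L[ℝ] (Fin k → ℝ)) where
  toFun φ := ContinuousLinearMap.pi fun α => φ.comp ((ContinuousLinearMap.inr ℝ B V).comp (s α))
  map_add' _ _ := rfl
  map_smul' _ _ := rfl

/-- The `k`-covector obtained by restricting a covector to `k` slots `sₐ : B → V` of the
fibre. -/
def fibreCovector (s : Fin k → B →L[ℝ] V) : (B × V →L[ℝ] ℝ) →L[ℝ] (B →L[ℝ] (Fin k → ℝ)) :=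
  LinearMap.toContinuousLinearMap (fibreCovectorLin s)

@[simp] theorem fibreCovector_apply (s : Fin k → B →L[ℝ] V) (φ : B × V →L[ℝ] ℝ) (u : B)
    (α : Fin k) : fibreCovector s φ u α = φ (0, s α u) := rfl

/-- The Legendre transformation in coordinates. -/
def legLoc (s : Fin k → B →L[ℝ] V) (l : B × V → ℝ) (y : B × V) : B × (B →L[ℝ] (Fin k → ℝ)) :=
  (y.1, fibreCovector s (fderiv ℝ l y))

/-- The energy in coordinates. -/
def energyLoc (l : B × V → ℝ) (y : B × V) : ℝ := fderiv ℝ l y (0, y.2) - l y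

/-- The form `∑ₐ i(Xₐ) ωᵃ` in coordinates: it is the pull-back of the canonical one. -/
def omegaLoc (s : Fin k → B →L[ℝ] V) (l : B × V → ℝ) (y : B × V) (X : Fin k → B × V)
    (w : B × V) : ℝ :=
  ∑ α, ((fderiv ℝ (legLoc s l) y w).2 (X α).1 α - (fderiv ℝ (legLoc s l) y (X α)).2 w.1 α)

variable {s : Fin k → B →L[ℝ] V} {c : Fin k → V →L[ℝ] B}
  {l : B × V → ℝ} {y : B × V}

theorem sum_fibreCovector (hsc : ∀ A, ∑ α, s α (c α A) = A) (φ : B × V →L[ℝ] ℝ) (A : V) :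
    ∑ α, fibreCovector s φ (c α A) α = φ (0, A) := by
  have h : ((0, A) : B × V) = ∑ α, (0, s α (c α A)) := by
    ext1
    · simp [Prod.fst_sum]
    · simp only [Prod.snd_sum]; exact (hsc A).symm
  rw [h, map_sum]
  rfl

theorem hasFDerivAt_fderiv (h : ContDiffAt ℝ ∞ l y) :
    HasFDerivAt (fderiv ℝ l) (fderiv ℝ (fderiv ℝ l) y) y :=
  ((h.fderiv_right (m := ∞) (by simp)).differentiableAt (by simp)).hasFDerivAt

theorem contDiffAt_legLoc (h : ContDiffAt ℝ ∞ l y) : ContDiffAt ℝ ∞ (legLoc s l) y :=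
  contDiffAt_fst.prodMk ((fibreCovector s).contDiff.contDiffAt.comp y
    (h.fderiv_right (m := ∞) (by simp)))

theorem fderiv_legLoc (h : ContDiffAt ℝ ∞ l y) (w : B × V) :
    fderiv ℝ (legLoc s l) y w = (w.1, fibreCovector s (fderiv ℝ (fderiv ℝ l) y w)) := by
  have h1 : HasFDerivAt (legLoc s l) ((ContinuousLinearMap.fst ℝ B V).prod
      ((fibreCovector s).comp (fderiv ℝ (fderiv ℝ l) y))) y :=
    hasFDerivAt_fst.prodMk ((fibreCovector s).hasFDerivAt.comp y (hasFDerivAt_fderiv h))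
  rw [h1.fderiv]
  rfl

theorem fderiv_fderiv_comm (h : ContDiffAt ℝ ∞ l y) (u w : B × V) :
    fderiv ℝ (fderiv ℝ l) y u w = fderiv ℝ (fderiv ℝ l) y w u :=
  (h.isSymmSndFDerivAt (by rw [minSmoothness_of_isRCLikeNormedField]; norm_cast)).eq u w

/-- A Hessian entry with one vertical argument is visible through the derivative of the Legendre map
alone; this lets such entries be compared at different points of a fibre. -/
theorem sum_fderiv_legLoc (hsc : ∀ A, ∑ α, s α (c α A) = A) (h : ContDiffAt ℝ ∞ l y)
    (w : B × V) (A : V) :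
    ∑ α, (fderiv ℝ (legLoc s l) y w).2 (c α A) α = fderiv ℝ (fderiv ℝ l) y w (0, A) := by
  rw [fderiv_legLoc h]
  exact sum_fibreCovector hsc _ _

/-- The Legendre map preserves the base point, so its kernel is vertical; what remains is the
degeneracy of the vertical Hessian. -/
theorem fderiv_legLoc_eq_zero (hsc : ∀ A, ∑ α, s α (c α A) = A) (h : ContDiffAt ℝ ∞ l y)
    (w : B × V) : fderiv ℝ (legLoc s l) y w = 0 ↔
      w.1 = 0 ∧ ∀ A, fderiv ℝ (fderiv ℝ l) y w (0, A) = 0 := by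
  rw [fderiv_legLoc h, Prod.mk_eq_zero]
  refine and_congr_right fun _ => ⟨fun h2 A => ?_, fun h2 => ?_⟩
  · rw [← sum_fibreCovector hsc, h2]; simp
  · ext u α
    exact h2 _

/-- This is dE = ∑ v_α dp^α - (∂l/∂q) dq: the two contributions of ∂l/∂v cancel. Only the last term
is not expressed through the Legendre map. -/
theorem fderiv_energyLoc (hsc : ∀ A, ∑ α, s α (c α A) = A) (h : ContDiffAt ℝ ∞ l y)
    (w : B × V) :
    fderiv ℝ (energyLoc l) y w =
      ∑ α, (fderiv ℝ (legLoc s l) y w).2 (c α y.2) α - fderiv ℝ l y (w.1, 0) := by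
  have hs : HasFDerivAt (fun z : B × V => ((0, z.2) : B × V))
      ((0 : B × V →L[ℝ] B).prod (ContinuousLinearMap.snd ℝ B V)) y :=
    (hasFDerivAt_const _ _).prodMk hasFDerivAt_snd
  have h1 := ((hasFDerivAt_fderiv h).clm_apply hs).sub
    (h.differentiableAt (by simp)).hasFDerivAt
  have h2 : fderiv ℝ (energyLoc l) y = _ := h1.fderiv
  rw [h2, sum_fderiv_legLoc hsc h]
  have h3 : w = (0, w.2) + (w.1, 0) := by simp
  have h4 : fderiv ℝ l y w = fderiv ℝ l y (0, w.2) + fderiv ℝ l y (w.1, 0) := by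
    rw [← map_add, ← h3]
  simp [h4]

/-- Moving along a segment on which `a` stays in the kernel of the vertical Hessian and the range
of the derivative of the Legendre transformation does not change, the differential of the energy
does not change either. -/
theorem fderiv_energyLoc_eq (hsc : ∀ A, ∑ α, s α (c α A) = A) {x : B × V} {a : V} {ε : ℝ}
    (hl : ∀ r ∈ Metric.ball (0 : ℝ) ε, ContDiffAt ℝ ∞ l (x + r • (0, a)))
    (hker : ∀ r ∈ Metric.ball (0 : ℝ) ε, fderiv ℝ (legLoc s l) (x + r • (0, a)) (0, a) = 0)
    (hrange : ∀ r ∈ Metric.ball (0 : ℝ) ε, ∀ w, ∃ w',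
      fderiv ℝ (legLoc s l) (x + r • (0, a)) w' = fderiv ℝ (legLoc s l) x w)
    {t : ℝ} (ht : t ∈ Metric.ball (0 : ℝ) ε) {w w' : B × V}
    (hw : fderiv ℝ (legLoc s l) (x + t • (0, a)) w' = fderiv ℝ (legLoc s l) x w) :
    fderiv ℝ (energyLoc l) (x + t • (0, a)) w' = fderiv ℝ (energyLoc l) x w := by
  have h0 : (0 : ℝ) ∈ Metric.ball (0 : ℝ) ε := by
    simpa using (dist_nonneg.trans_lt (Metric.mem_ball.1 ht))
  have hlx : ContDiffAt ℝ ∞ l x := by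
    have := hl 0 h0
    rwa [zero_smul, add_zero] at this
  have hw1 : w'.1 = w.1 := by
    have := congrArg Prod.fst hw
    rwa [fderiv_legLoc (hl t ht), fderiv_legLoc hlx] at this
  rw [fderiv_energyLoc hsc (hl t ht), fderiv_energyLoc hsc hlx, hw, hw1]
  -- m is the common rate of change, along the segment, of both terms of dE: of ∑ v_α dp^α because v
  -- moves by r a, and of (∂l/∂q) dq by the computation below. Their difference is therefore
  -- constant.
  set m : ℝ := ∑ α, (fderiv ℝ (legLoc s l) x w).2 (c α a) α with hm
  have hderiv : ∀ r ∈ Metric.ball (0 : ℝ) ε,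
      HasDerivAt (fun r : ℝ => fderiv ℝ l (x + r • (0, a)) (w.1, 0) - r * m) 0 r := by
    intro r hr
    have hline : HasDerivAt (fun r : ℝ => x + r • ((0, a) : B × V)) (0, a) r := by
      simpa using ((hasDerivAt_id r).smul_const ((0, a) : B × V)).const_add x
    have h1 : HasDerivAt (fun r : ℝ => fderiv ℝ l (x + r • (0, a)))
        (fderiv ℝ (fderiv ℝ l) (x + r • (0, a)) (0, a)) r :=
      (hasFDerivAt_fderiv (hl r hr)).comp_hasDerivAt r hline
    have h2 := (h1.clm_apply (hasDerivAt_const r ((w.1, 0) : B × V))).sub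
      ((hasDerivAt_id r).mul_const m)
    refine h2.congr_deriv ?_
    obtain ⟨u, hu⟩ := hrange r hr w
    have hu1 : u.1 = w.1 := by
      have := congrArg Prod.fst hu
      rwa [fderiv_legLoc (hl r hr), fderiv_legLoc hlx] at this
    -- Replace w by a vector u at the current point with the same image. Then m is the Hessian of u
    -- against (0, a), and the vertical part of u drops out since (0, a) is in the kernel.
    have h3 : m = fderiv ℝ (fderiv ℝ l) (x + r • (0, a)) (0, a) (w.1, 0) := by
      rw [hm, ← hu, sum_fderiv_legLoc hsc (hl r hr), fderiv_fderiv_comm (hl r hr)]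
      have h4 : u = (w.1, 0) + (0, u.2) := by rw [← hu1]; simp
      rw [h4, map_add, ((fderiv_legLoc_eq_zero hsc (hl r hr) _).1 (hker r hr)).2, add_zero]
    simp [h3]
  have hconst := (convex_ball (0 : ℝ) ε).is_const_of_fderivWithin_eq_zero (𝕜 := ℝ)
      (f := fun r : ℝ => fderiv ℝ l (x + r • (0, a)) (w.1, 0) - r * m)
      (fun r hr => (hderiv r hr).differentiableAt.differentiableWithinAt)
      (fun r hr => by
        rw [fderivWithin_of_isOpen Metric.isOpen_ball hr, (hderiv r hr).hasFDerivAt.fderiv]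
        simp) ht h0
  rw [zero_smul, add_zero, zero_mul, sub_zero] at hconst
  have hsum : ∑ α, (fderiv ℝ (legLoc s l) x w).2 (c α (x + t • (0, a)).2) α =
      ∑ α, (fderiv ℝ (legLoc s l) x w).2 (c α x.2) α + t * m := by
    rw [hm, Finset.mul_sum, ← Finset.sum_add_distrib]
    refine Finset.sum_congr rfl fun α _ => ?_
    simp
  rw [hsum]
  linarith

/-- The vertical direction carried by an element of `Ker Ω` is in the kernel of the vertical
Hessian. -/
theorem fderiv_legLoc_of_omegaLoc_eq_zero (hsc : ∀ A, ∑ α, s α (c α A) = A)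
    (h : ContDiffAt ℝ ∞ l y) {X : Fin k → B × V} (hX : ∀ w, omegaLoc s l y X w = 0) :
    fderiv ℝ (legLoc s l) y (0, ∑ α, s α (X α).1) = 0 := by
  rw [fderiv_legLoc_eq_zero hsc h]
  refine ⟨rfl, fun A => ?_⟩
  -- Against a vertical vector the second half of Ω vanishes, leaving the Hessian of (0, A) with the
  -- base components of X placed in the fibre slots.
  have h1 := hX (0, A)
  simp only [omegaLoc, fderiv_legLoc h, fibreCovector_apply, map_zero, sub_zero,
    Prod.mk_zero_zero] at h1
  rw [fderiv_fderiv_comm h, ← h1, ← map_sum]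
  congr 1
  ext1
  · simp [Prod.fst_sum]
  · simp [Prod.snd_sum]

end Coordinates

/-! ### Local structure of the fibres of the Legendre map. -/

section LocalFibre

variable {k : ℕ} {B V E : Type*} [NormedAddCommGroup B] [NormedSpace ℝ B] [FiniteDimensional ℝ B]
  [NormedAddCommGroup V] [NormedSpace ℝ V] [FiniteDimensional ℝ V]
  [NormedAddCommGroup E] [NormedSpace ℝ E] [FiniteDimensional ℝ E]

/-- The kernel of the derivative of the Legendre transformation is determined by its range. -/
theorem fderiv_legLoc_eq_zero_of_range {s : Fin k → B →L[ℝ] V} {c : Fin k → V →L[ℝ] B}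
    {l : B × V → ℝ} {x y : B × V} (hsc : ∀ A, ∑ α, s α (c α A) = A)
    (hx : ContDiffAt ℝ ∞ l x) (hy : ContDiffAt ℝ ∞ l y)
    (hxy : ∀ w, ∃ w', fderiv ℝ (legLoc s l) x w = fderiv ℝ (legLoc s l) y w') {a : B × V}
    (ha : fderiv ℝ (legLoc s l) y a = 0) : fderiv ℝ (legLoc s l) x a = 0 := by
  obtain ⟨ha1, ha2⟩ := (fderiv_legLoc_eq_zero hsc hy a).1 ha
  refine (fderiv_legLoc_eq_zero hsc hx a).2 ⟨ha1, fun A => ?_⟩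
  have ha' : a = (0, a.2) := by rw [← ha1]
  -- The Hessian at x of a with (0, A) is the pairing of a with the image of (0, A). That image is
  -- also the image of some w at y, which is again vertical, and there the pairing with a is zero.
  obtain ⟨w, hw⟩ := hxy (0, A)
  have hw1 : w.1 = 0 := by
    have := congrArg Prod.fst hw
    rw [fderiv_legLoc hx, fderiv_legLoc hy] at this
    exact this.symm
  have hw' : w = (0, w.2) := by rw [← hw1]
  rw [fderiv_fderiv_comm hx, ha', ← sum_fderiv_legLoc hsc hx, hw, sum_fderiv_legLoc hsc hy,
    ← ha', fderiv_fderiv_comm hy, hw', ha2]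

theorem differentiableAt_comp_legLoc {s : Fin k → B →L[ℝ] V} {l : B × V → ℝ} {y : B × V}
    (h : ContDiffAt ℝ ∞ l y) {κ : B × (B →L[ℝ] (Fin k → ℝ)) → E}
    (hκ : ContDiffAt ℝ ∞ κ (legLoc s l y)) : DifferentiableAt ℝ (fun z => κ (legLoc s l z)) y :=
  (hκ.differentiableAt (by simp)).comp y ((contDiffAt_legLoc h).differentiableAt (by simp))

/-- Suppose that, after the change of coordinates `κ`, the Legendre transformation is near `x` a
submersion onto an affine subspace. Then its fibre through `x` contains the points `x + t (0, a)`
for `a` in the kernel of the vertical Hessian and `t` small, and at these points the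
Legendre transformation has the same infinitesimal data as at `x`. -/
theorem eventually_legLoc_fibre {s : Fin k → B →L[ℝ] V} {c : Fin k → V →L[ℝ] B}
    {l : B × V → ℝ} {x : B × V} (hsc : ∀ A, ∑ α, s α (c α A) = A)
    (hl : ∀ᶠ y in 𝓝 x, ContDiffAt ℝ ∞ l y)
    {κ : B × (B →L[ℝ] (Fin k → ℝ)) → E} {κ' : E → B × (B →L[ℝ] (Fin k → ℝ))}
    (hκ : ∀ᶠ p in 𝓝 (legLoc s l x), ContDiffAt ℝ 1 κ p)
    (hκ' : DifferentiableAt ℝ κ' (κ (legLoc s l x)))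
    (hκκ : ∀ᶠ p in 𝓝 (legLoc s l x), κ' (κ p) = p) {F : Submodule ℝ E}
    (hF : ∀ᶠ y in 𝓝 x, κ (legLoc s l y) - κ (legLoc s l x) ∈ F)
    (hrange : ∀ᶠ y in 𝓝 x, legLoc s l y = legLoc s l x →
      Set.range (fderiv ℝ (fun z => κ (legLoc s l z)) y) = F)
    {a : V} (ha : fderiv ℝ (legLoc s l) x (0, a) = 0) :
    ∀ᶠ t in 𝓝 (0 : ℝ), legLoc s l (x + t • (0, a)) = legLoc s l x ∧
      (∀ w, ∃ w', fderiv ℝ (legLoc s l) (x + t • (0, a)) w' = fderiv ℝ (legLoc s l) x w) ∧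
      (∀ w', ∃ w, fderiv ℝ (legLoc s l) (x + t • (0, a)) w' = fderiv ℝ (legLoc s l) x w) ∧
      (∀ w w', fderiv ℝ (legLoc s l) (x + t • (0, a)) w' = fderiv ℝ (legLoc s l) x w →
        fderiv ℝ (energyLoc l) (x + t • (0, a)) w' = fderiv ℝ (energyLoc l) x w) ∧
      ∀ (f : B × V → ℝ) (h : B × (B →L[ℝ] (Fin k → ℝ)) → ℝ), DifferentiableAt ℝ f x →
        DifferentiableAt ℝ f (x + t • (0, a)) → (∀ᶠ z in 𝓝 x, f z = h (legLoc s l z)) →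
        (∀ᶠ z in 𝓝 (x + t • (0, a)), f z = h (legLoc s l z)) →
        ∀ w w', fderiv ℝ (legLoc s l) (x + t • (0, a)) w' = fderiv ℝ (legLoc s l) x w →
          fderiv ℝ f (x + t • (0, a)) w' = fderiv ℝ f x w := by
  set leg := legLoc s l with hleg
  set G : B × V → E := fun z => κ (leg z) with hG
  have hlx : ContDiffAt ℝ ∞ l x := hl.self_of_nhds
  have hlegc : ContinuousAt leg x := (contDiffAt_legLoc hlx).continuousAt
  have hκl : ∀ᶠ y in 𝓝 x, ContDiffAt ℝ 1 κ (leg y) := hlegc.eventually hκ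
  have hGc : ∀ᶠ y in 𝓝 x, ContDiffAt ℝ 1 G y := by
    filter_upwards [hl, hκl] with y h1 h2
    exact h2.comp y ((contDiffAt_legLoc h1).of_le (by norm_cast))
  have hGleg : ∀ᶠ y in 𝓝 x, G y = G x → leg y = leg x := by
    filter_upwards [hlegc.eventually hκκ] with y h1 h2
    rw [← h1, ← hκκ.self_of_nhds]
    exact congrArg κ' h2
  set D := fderiv ℝ κ (leg x) with hD
  -- κ has a differentiable local left inverse, so statements about the derivative of G = κ ∘ leg
  -- descend to the derivative of the Legendre map.
  have hDinj : ∀ p q, D p = D q → p = q := by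
    have h1 : HasFDerivAt (fun p => κ' (κ p)) ((fderiv ℝ κ' (κ (leg x))).comp D) (leg x) :=
      hκ'.hasFDerivAt.comp (leg x) (hκ.self_of_nhds.differentiableAt one_ne_zero).hasFDerivAt
    have h2 : HasFDerivAt (fun p => κ' (κ p)) (ContinuousLinearMap.id ℝ _) (leg x) :=
      (hasFDerivAt_id (leg x)).congr_of_eventuallyEq hκκ
    have h3 := h1.unique h2
    intro p q hpq
    have hp := DFunLike.congr_fun h3 p
    have hq := DFunLike.congr_fun h3 q
    simp only [ContinuousLinearMap.comp_apply, ContinuousLinearMap.id_apply] at hp hq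
    rw [← hp, ← hq, hpq]
  have hDG : ∀ᶠ y in 𝓝 x, leg y = leg x → ∀ w, fderiv ℝ G y w = D (fderiv ℝ leg y w) := by
    filter_upwards [hl, hκl] with y h1 h2 h3 w
    have h4 : HasFDerivAt G ((fderiv ℝ κ (leg y)).comp (fderiv ℝ leg y)) y :=
      (h2.differentiableAt one_ne_zero).hasFDerivAt.comp y
        ((contDiffAt_legLoc h1).differentiableAt (by simp)).hasFDerivAt
    rw [h4.fderiv, h3]
    rfl
  have hFx : ((F : Set E)) = Set.range (fderiv ℝ G x) := (hrange.self_of_nhds rfl).symm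
  have hmem : ∀ᶠ y in 𝓝 x, leg y = leg x → ∀ᶠ z in 𝓝 y, ∃ w, G z - G y = fderiv ℝ G y w := by
    filter_upwards [hF.eventually_nhds, hrange] with y h1 h2 h3
    filter_upwards [h1] with z hz
    have h4 : G z - G y ∈ (F : Set E) := by
      have : G y = G x := congrArg κ h3
      rw [this]; exact hz
    rw [← h2 h3] at h4
    obtain ⟨w, hw⟩ := h4
    exact ⟨w, hw.symm⟩
  have hsame : ∀ᶠ y in 𝓝 x, leg y = leg x →
      (∀ w, ∃ w', fderiv ℝ leg y w' = fderiv ℝ leg x w) ∧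
      (∀ w', ∃ w, fderiv ℝ leg y w' = fderiv ℝ leg x w) := by
    filter_upwards [hDG, hrange] with y h1 h2 h3
    have h4 : Set.range (fderiv ℝ G y) = Set.range (fderiv ℝ G x) := by rw [h2 h3, hFx]
    refine ⟨fun w => ?_, fun w' => ?_⟩
    · obtain ⟨w', hw'⟩ : fderiv ℝ G x w ∈ Set.range (fderiv ℝ G y) := h4 ▸ ⟨w, rfl⟩
      refine ⟨w', hDinj _ _ ?_⟩
      rw [← h1 h3, hw', hDG.self_of_nhds rfl]
    · obtain ⟨w, hw⟩ : fderiv ℝ G y w' ∈ Set.range (fderiv ℝ G x) := h4 ▸ ⟨w', rfl⟩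
      refine ⟨w, hDinj _ _ ?_⟩
      rw [← h1 h3, ← hw, hDG.self_of_nhds rfl]
  have hker : ∀ᶠ y in 𝓝 x, G y = G x → ∀ w, fderiv ℝ G y w = 0 → fderiv ℝ G x w = 0 := by
    filter_upwards [hl, hGleg, hDG, hsame] with y h1 h2 h3 h4 h5 w h6
    have h7 : fderiv ℝ leg y w = 0 := hDinj _ _ (by rw [← h3 (h2 h5), h6, map_zero])
    rw [hDG.self_of_nhds rfl, fderiv_legLoc_eq_zero_of_range hsc hlx h1
      (fun w => ((h4 (h2 h5)).1 w).imp fun _ => Eq.symm) h7, map_zero]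
  have hline : Tendsto (fun t : ℝ => x + t • ((0, a) : B × V)) (𝓝 0) (𝓝 x) :=
    tendsto_add_smul x (0, a)
  have hGa : fderiv ℝ G x (0, a) = 0 := by rw [hDG.self_of_nhds rfl, ha, map_zero]
  have hfib : ∀ᶠ t in 𝓝 (0 : ℝ), leg (x + t • (0, a)) = leg x := by
    filter_upwards [eventually_fibre_of_ker hGc.self_of_nhds (hmem.self_of_nhds rfl) hker hGa,
      hline.eventually hGleg] with t h1 h2
    exact h2 h1
  -- One radius ε must serve the whole segment, because the comparison of energy differentials at
  -- parameter t integrates from 0 to t.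
  have hall := hfib.and ((hline.eventually hl).and (hline.eventually hsame))
  obtain ⟨ε, hε, hball⟩ := Metric.eventually_nhds_iff_ball.1 hall
  have hken : ∀ r ∈ Metric.ball (0 : ℝ) ε, fderiv ℝ leg (x + r • (0, a)) (0, a) = 0 := by
    intro r hr
    obtain ⟨h1, h2, h3⟩ := hball r hr
    exact fderiv_legLoc_eq_zero_of_range hsc h2 hlx (h3 h1).2 ha
  filter_upwards [Metric.ball_mem_nhds (0 : ℝ) hε, hline.eventually hGc, hline.eventually hmem,
    hline.eventually hDG, hline.eventually (hlegc.eventually hκκ).eventually_nhds]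
    with t ht hGt hmt hDt hκt
  obtain ⟨h1, h2, h3⟩ := hball t ht
  refine ⟨h1, (h3 h1).1, (h3 h1).2, fun w w' hw => ?_, fun f h hfx hfy hhx hhy w w' hw => ?_⟩
  · exact fderiv_energyLoc_eq hsc (fun r hr => (hball r hr).2.1) hken
      (fun r hr => ((hball r hr).2.2 (hball r hr).1).1) ht hw
  · refine fderiv_eq_of_factors (G := G) (h := fun e => h (κ' e)) hGt hGc.self_of_nhds (hmt h1)
      (hmem.self_of_nhds rfl) (congrArg κ h1) hfy hfx ?_ ?_ ?_
    · filter_upwards [hhy, hκt] with z hz hz'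
      simp only [hG, hz', hz]
    · filter_upwards [hhx, hlegc.eventually hκκ] with z hz hz'
      simp only [hG, hz', hz]
    · rw [hDt h1, hDG.self_of_nhds rfl, hw]

end LocalFibre

/-! ### The `k`-tangent and `k`-cotangent bundles in a chart -/

section Charts

variable {k n : ℕ} {Q : Type*} [TopologicalSpace Q] [ChartedSpace (EuclideanSpace ℝ (Fin n)) Q]
  [IsManifold (𝓡 n) ∞ Q]

/-- The insertion of a vector as the `α`-th component of a `k`-tuple of vectors. -/
def slot (α : Fin k) : Base n →L[ℝ] VelFibre k n :=
  ContinuousLinearMap.smulRightL ℝ (Fin k → ℝ) (Base n)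
    (ContinuousLinearMap.proj α : (Fin k → ℝ) →L[ℝ] ℝ)

/-- The `α`-th component of a `k`-tuple of vectors. -/
def component (α : Fin k) : VelFibre k n →L[ℝ] Base n :=
  ContinuousLinearMap.apply ℝ (Base n) (Pi.single α 1 : Fin k → ℝ)

@[simp] theorem slot_apply (α : Fin k) (u : Base n) (r : Fin k → ℝ) : slot α u r = r α • u := rfl

@[simp] theorem component_apply (α : Fin k) (A : VelFibre k n) :
    component α A = A (Pi.single α 1) := rfl

theorem sum_slot (A : VelFibre k n) : ∑ α, slot α (component α A) = A := by
  ext1 r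
  rw [sum_apply]
  conv_rhs => rw [pi_eq_sum_univ' r]
  simp only [map_sum, map_smul, slot_apply, component_apply]

theorem component_sum_slot (u : Fin k → Base n) (α : Fin k) :
    component α (∑ β, slot β (u β)) = u α := by
  simp [component_apply, Pi.single_apply]

/-- The tangent coordinates at `q` in the chart at `q₀`. -/
def tanCoord (q₀ q : Q) : TangentSpace (𝓡 n) q →L[ℝ] Base n :=
  (trivializationAt (Base n) (TangentSpace (𝓡 n)) q₀).continuousLinearMapAt ℝ q

/-- The inverse of the tangent coordinates. -/
def tanCoordSymm (q₀ q : Q) : Base n →L[ℝ] TangentSpace (𝓡 n) q :=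
  (trivializationAt (Base n) (TangentSpace (𝓡 n)) q₀).symmL ℝ q

theorem tanCoord_tanCoordSymm {q₀ q : Q} (hq : q ∈ (chartAt (Base n) q₀).source) (u : Base n) :
    tanCoord q₀ q (tanCoordSymm q₀ q u) = u :=
  (trivializationAt (Base n) (TangentSpace (𝓡 n)) q₀).continuousLinearMapAt_symmL hq u

theorem tanCoord_eq_mfderiv {q₀ q : Q} (hq : q ∈ (chartAt (Base n) q₀).source) :
    tanCoord q₀ q = mfderiv (𝓡 n) 𝓘(ℝ, Base n) (extChartAt (𝓡 n) q₀) q :=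
  TangentBundle.continuousLinearMapAt_trivializationAt hq

theorem tanCoord_self (q : Q) (u : TangentSpace (𝓡 n) q) : tanCoord q q u = u := by
  rw [tanCoord, TangentBundle.continuousLinearMapAt_trivializationAt_eq_core (mem_chart_source _ q)]
  exact (tangentBundleCore (𝓡 n) Q).coordChange_self (achart _ q) q (mem_chart_source _ q) u

theorem mem_extChartAt_source_iff (x₀ x : KTangent k n Q) :
    x ∈ (extChartAt (modelT k n) x₀).source ↔ x.proj ∈ (chartAt (Base n) x₀.proj).source := by
  rw [FiberBundle.extChartAt]
  simp only [hom_trivializationAt_source, mfld_simps]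
  rw [hom_trivializationAt_apply]
  tauto

theorem extChartAt_apply (x₀ x : KTangent k n Q) :
    extChartAt (modelT k n) x₀ x =
      (extChartAt (𝓡 n) x₀.proj x.proj, (tanCoord x₀.proj x.proj).comp x.2) := by
  rw [FiberBundle.extChartAt]
  have := hom_trivializationAt_apply (RingHom.id ℝ) (F₁ := Fin k → ℝ)
    (E₁ := Bundle.Trivial Q (Fin k → ℝ)) (F₂ := Base n)
    (E₂ := fun q : Q => TangentSpace (𝓡 n) q) x₀.proj x
  simp [ContinuousLinearMap.inCoordinates] at this
  simp [this]
  rfl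

theorem mem_extChartAt_source_iff_cotangent (p₀ p : KCotangent k n Q) :
    p ∈ (extChartAt (modelC k n) p₀).source ↔ p.proj ∈ (chartAt (Base n) p₀.proj).source := by
  rw [FiberBundle.extChartAt]
  simp only [hom_trivializationAt_source, mfld_simps]
  rw [hom_trivializationAt_apply]
  tauto

theorem extChartAt_apply_cotangent (p₀ p : KCotangent k n Q) :
    extChartAt (modelC k n) p₀ p =
      (extChartAt (𝓡 n) p₀.proj p.proj, p.2.comp (tanCoordSymm p₀.proj p.proj)) := by
  rw [FiberBundle.extChartAt]
  have := hom_trivializationAt_apply (RingHom.id ℝ) (F₂ := Fin k → ℝ)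
    (E₂ := Bundle.Trivial Q (Fin k → ℝ)) (F₁ := Base n)
    (E₁ := fun q : Q => TangentSpace (𝓡 n) q) p₀.proj p
  simp [ContinuousLinearMap.inCoordinates] at this
  simp [this]
  rfl

/-- The chart at a point of the `k`-tangent bundle only depends on the base point. -/
theorem extChartAt_congr {x₀ x : KTangent k n Q} (h : x.proj = x₀.proj) :
    extChartAt (modelT k n) x = extChartAt (modelT k n) x₀ := by
  obtain ⟨q, v⟩ := x
  obtain rfl : q = x₀.proj := h
  rfl

theorem extChartAt_apply_self (x : KTangent k n Q) :
    extChartAt (modelT k n) x x = (extChartAt (𝓡 n) x.proj x.proj, x.2) := by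
  rw [extChartAt_apply]
  congr 1
  ext1 r
  exact tanCoord_self _ _

end Charts

/-! ### Differentials of the charts on vertical vectors and of the projection. -/

variable {k n : ℕ} {Q : Type*} [TopologicalSpace Q] [ChartedSpace (EuclideanSpace ℝ (Fin n)) Q]
  [IsManifold (𝓡 n) ∞ Q]

theorem mdifferentiableAt_fibre_inclusion (q : Q) (w : VelFibre k n) :
    MDifferentiableAt 𝓘(ℝ, VelFibre k n) (modelT k n)
      (fun w : VelFibre k n => (⟨q, w⟩ : KTangent k n Q)) w := by
  have h : ContMDiffAt 𝓘(ℝ, VelFibre k n) (modelT k n) ∞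
      (fun w : VelFibre k n => (⟨q, w⟩ : KTangent k n Q)) w := by
    rw [Bundle.contMDiffAt_totalSpace]
    refine ⟨contMDiffAt_const, ?_⟩
    have h1 : ∀ w : VelFibre k n, (trivializationAt (VelFibre k n)
        (fun q : Q => Bundle.Trivial Q (Fin k → ℝ) q →L[ℝ] TangentSpace (𝓡 n) q) q
          (⟨q, w⟩ : KTangent k n Q)).2 = w := fun w =>
      congrArg Prod.snd (extChartAt_apply_self (⟨q, w⟩ : KTangent k n Q))
    simp only [h1]
    exact contMDiffAt_id
  exact h.mdifferentiableAt (by simp)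

theorem mdifferentiableAt_chart {x₀ x : KTangent k n Q}
    (hx : x ∈ (extChartAt (modelT k n) x₀).source) :
    MDifferentiableAt (modelT k n) 𝓘(ℝ, Base n × VelFibre k n) (extChartAt (modelT k n) x₀) x :=
  (contMDiffAt_extChartAt' (n := ∞) (by rwa [← extChartAt_source (modelT k n)])).mdifferentiableAt
    (by simp)

/-- Restricted to one fibre the chart is constant in the base component and linear in the fibre
component, so its derivative can be read off. -/
theorem mfderiv_chart_fibreLift {x₀ x : KTangent k n Q}
    (hx : x ∈ (extChartAt (modelT k n) x₀).source) (A : VelFibre k n) :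
    mfderiv (modelT k n) 𝓘(ℝ, Base n × VelFibre k n) (extChartAt (modelT k n) x₀) x
      (fibreLift x A) = ((0 : Base n), ((tanCoord x₀.proj x.proj).comp A : VelFibre k n)) := by
  obtain ⟨q, v⟩ := x
  let T : VelFibre k n →L[ℝ] VelFibre k n :=
    ContinuousLinearMap.compL ℝ (Fin k → ℝ) (Base n) (Base n) (tanCoord x₀.proj q)
  have h1 := mfderiv_comp (M := VelFibre k n) (I := 𝓘(ℝ, VelFibre k n)) (I' := modelT k n)
    (I'' := 𝓘(ℝ, Base n × VelFibre k n)) (x := v)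
    (f := fun w : VelFibre k n => (⟨q, w⟩ : KTangent k n Q)) (mdifferentiableAt_chart hx)
    (mdifferentiableAt_fibre_inclusion q v)
  have h2 : (extChartAt (modelT k n) x₀ ∘ fun w : VelFibre k n => (⟨q, w⟩ : KTangent k n Q)) =
      fun w : VelFibre k n => (extChartAt (𝓡 n) x₀.proj q, T w) :=
    funext fun w => extChartAt_apply x₀ _
  have h3 : HasFDerivAt (fun w : VelFibre k n => (extChartAt (𝓡 n) x₀.proj q, T w))
      ((0 : VelFibre k n →L[ℝ] Base n).prod T) v :=
    (hasFDerivAt_const _ _).prodMk T.hasFDerivAt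
  rw [h2, h3.hasMFDerivAt.mfderiv] at h1
  exact (DFunLike.congr_fun h1 A).symm

theorem tanCoord_dproj {x₀ x : KTangent k n Q}
    (hx : x ∈ (extChartAt (modelT k n) x₀).source) (w : Tan x) :
    tanCoord x₀.proj x.proj (dproj x w) =
      (mfderiv (modelT k n) 𝓘(ℝ, Base n × VelFibre k n) (extChartAt (modelT k n) x₀) x w :
        Base n × VelFibre k n).1 := by
  have hq : x.proj ∈ (chartAt (Base n) x₀.proj).source := (mem_extChartAt_source_iff _ _).1 hx
  have hd : MDifferentiableAt (modelT k n) (𝓡 n) (fun y : KTangent k n Q => y.proj) x :=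
    (Bundle.contMDiffAt_proj (n := ∞) _).mdifferentiableAt (by simp)
  have hc : MDifferentiableAt (𝓡 n) 𝓘(ℝ, Base n) (extChartAt (𝓡 n) x₀.proj) x.proj :=
    (contMDiffAt_extChartAt' (n := ∞) hq).mdifferentiableAt (by simp)
  have h1 := mfderiv_comp x hc hd
  have h2 := mfderiv_comp (I := modelT k n) (I' := 𝓘(ℝ, Base n × VelFibre k n)) x
    (g := fun p : Base n × VelFibre k n => p.1)
    (differentiableAt_fst.mdifferentiableAt) (mdifferentiableAt_chart hx)
  have h3 : ((fun p : Base n × VelFibre k n => p.1) ∘ extChartAt (modelT k n) x₀) =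
      (extChartAt (𝓡 n) x₀.proj ∘ fun y : KTangent k n Q => y.proj) :=
    funext fun y => congrArg Prod.fst (extChartAt_apply x₀ y)
  rw [h3] at h2
  rw [tanCoord_eq_mfderiv hq]
  have h4 := DFunLike.congr_fun (h1.symm.trans h2) w
  refine h4.trans ?_
  rw [mfderiv_eq_fderiv, fderiv_fst]
  rfl

/-! ### Coordinate expressions valid on a whole chart domain. -/

section LocalExpressions

variable {k n : ℕ} {Q : Type*} [TopologicalSpace Q] [ChartedSpace (EuclideanSpace ℝ (Fin n)) Q]
  [IsManifold (𝓡 n) ∞ Q]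

/-- The expression of a function in the preferred chart at `x₀`. -/
def inChart (x₀ : KTangent k n Q) (f : KTangent k n Q → ℝ) (y : Base n × VelFibre k n) : ℝ :=
  f ((extChartAt (modelT k n) x₀).symm y)

theorem contDiffAt_inChart {f : KTangent k n Q → ℝ}
    (hf : ContMDiff (modelT k n) 𝓘(ℝ, ℝ) ∞ f) {x₀ : KTangent k n Q} {y : Base n × VelFibre k n}
    (hy : y ∈ (extChartAt (modelT k n) x₀).target) : ContDiffAt ℝ ∞ (inChart x₀ f) y := by
  have h1 := (contMDiffOn_extChartAt_symm (n := ∞) (I := modelT k n) x₀).contMDiffAt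
    (extChartAt_target_mem_nhds' hy)
  exact (ContMDiffAt.comp y hf.contMDiffAt h1).contDiffAt

theorem dfun_apply {f : KTangent k n Q → ℝ} {x₀ x : KTangent k n Q}
    (hx : x ∈ (extChartAt (modelT k n) x₀).source)
    (hf : DifferentiableAt ℝ (inChart x₀ f) (extChartAt (modelT k n) x₀ x)) (w : Tan x) :
    dfun f x w = fderiv ℝ (inChart x₀ f) (extChartAt (modelT k n) x₀ x)
      (mfderiv (modelT k n) 𝓘(ℝ, Base n × VelFibre k n) (extChartAt (modelT k n) x₀) x w) := by
  have h1 := mfderiv_comp (I := modelT k n) (I' := 𝓘(ℝ, Base n × VelFibre k n)) (I'' := 𝓘(ℝ, ℝ)) x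
    hf.mdifferentiableAt (mdifferentiableAt_chart hx)
  have h2 : f =ᶠ[𝓝 x] inChart x₀ f ∘ extChartAt (modelT k n) x₀ := by
    filter_upwards [extChartAt_source_mem_nhds' hx] with z hz
    simp only [Function.comp_apply, inChart]
    rw [(extChartAt (modelT k n) x₀).left_inv hz]
  rw [dfun, h2.mfderiv_eq, h1, mfderiv_eq_fderiv]
  rfl

theorem mfderiv_chart_verticalLift {x₀ x : KTangent k n Q}
    (hx : x ∈ (extChartAt (modelT k n) x₀).source) (α : Fin k)
    (u : TangentSpace (𝓡 n) x.proj) :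
    mfderiv (modelT k n) 𝓘(ℝ, Base n × VelFibre k n) (extChartAt (modelT k n) x₀) x
      (verticalLift α x u) = ((0 : Base n), (slot α (tanCoord x₀.proj x.proj u) : VelFibre k n)) := by
  have h := mfderiv_chart_fibreLift hx (slot α u)
  refine h.trans ?_
  congr 1
  ext1 r
  exact (tanCoord x₀.proj x.proj).map_smul (r α) u

theorem liouville_eq (x : KTangent k n Q) : liouville x = fibreLift x x.2 := by
  have h : (x.2 : VelFibre k n) = ∑ α, slot α (velocity x α) :=
    (sum_slot (x.2 : VelFibre k n)).symm
  calc liouville x = ∑ α, fibreLift x (slot α (velocity x α)) := rfl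
    _ = fibreLift x (∑ α, slot α (velocity x α)) := (map_sum (fibreLift x) _ _).symm
    _ = fibreLift x x.2 := congrArg (fibreLift x) h.symm

variable {L : KTangent k n Q → ℝ}

/-- Chart changes are linear on fibres, so the Liouville field reads (0, y.2) at every point of the
chart, not only over its centre. This is what allows differentiating the expression. -/
theorem energy_eq (hL : ContMDiff (modelT k n) 𝓘(ℝ, ℝ) ∞ L) {x₀ x : KTangent k n Q}
    (hx : x ∈ (extChartAt (modelT k n) x₀).source) :
    energy L x = energyLoc (inChart x₀ L) (extChartAt (modelT k n) x₀ x) := by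
  have hy := (extChartAt (modelT k n) x₀).map_source hx
  have h1 : dfun L x (liouville x) = fderiv ℝ (inChart x₀ L) (extChartAt (modelT k n) x₀ x)
      (0, (extChartAt (modelT k n) x₀ x).2) := by
    rw [liouville_eq]
    refine (dfun_apply hx ((contDiffAt_inChart hL hy).differentiableAt (by simp)) _).trans
      (congrArg _ ((mfderiv_chart_fibreLift hx _).trans ?_))
    rw [extChartAt_apply]
  rw [energy, h1, energyLoc, inChart, (extChartAt (modelT k n) x₀).left_inv hx]

/-- The cotangent chart uses the inverse tangent coordinates, which cancel the tangent coordinates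
produced by the vertical lift. -/
theorem extChartAt_legendre (hL : ContMDiff (modelT k n) 𝓘(ℝ, ℝ) ∞ L) {x₀ x : KTangent k n Q}
    (hx : x ∈ (extChartAt (modelT k n) x₀).source) :
    extChartAt (modelC k n) (legendre L x₀) (legendre L x) =
      legLoc slot (inChart x₀ L) (extChartAt (modelT k n) x₀ x) := by
  have hy := (extChartAt (modelT k n) x₀).map_source hx
  have hq : x.proj ∈ (chartAt (Base n) x₀.proj).source := (mem_extChartAt_source_iff _ _).1 hx
  rw [extChartAt_apply_cotangent, legLoc, extChartAt_apply]
  refine Prod.ext rfl ?_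
  ext u α
  rw [fibreCovector_apply]
  have h1 := dfun_apply hx ((contDiffAt_inChart hL hy).differentiableAt (by simp))
    (verticalLift α x (tanCoordSymm x₀.proj x.proj u))
  rw [mfderiv_chart_verticalLift hx, tanCoord_tanCoordSymm hq, extChartAt_apply] at h1
  exact h1

/-- This is θ^α = (∂l/∂v_α) dq, since in coordinates J^α moves the base component into slot α. -/
theorem cartanOne_eq (hL : ContMDiff (modelT k n) 𝓘(ℝ, ℝ) ∞ L) {x₀ : KTangent k n Q}
    {y : Base n × VelFibre k n} (hy : y ∈ (extChartAt (modelT k n) x₀).target) (α : Fin k)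
    (w : Base n × VelFibre k n) :
    cartanOne L α ((extChartAt (modelT k n) x₀).symm y)
      (mfderivWithin 𝓘(ℝ, Base n × VelFibre k n) (modelT k n) (extChartAt (modelT k n) x₀).symm
        (Set.range (modelT k n)) y w) =
      fderiv ℝ (inChart x₀ L) y (0, slot α w.1) := by
  have hx := (extChartAt (modelT k n) x₀).map_target hy
  have hyy := (extChartAt (modelT k n) x₀).right_inv hy
  have hd : DifferentiableAt ℝ (inChart x₀ L)
      (extChartAt (modelT k n) x₀ ((extChartAt (modelT k n) x₀).symm y)) := by
    rw [hyy]; exact (contDiffAt_inChart hL hy).differentiableAt (by simp)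
  have h1 := DFunLike.congr_fun
    (mfderiv_extChartAt_comp_mfderivWithin_extChartAt_symm (I := modelT k n) hy) w
  set z := mfderivWithin 𝓘(ℝ, Base n × VelFibre k n) (modelT k n)
    (extChartAt (modelT k n) x₀).symm (Set.range (modelT k n)) y w with hz
  have h2 : (mfderiv (modelT k n) 𝓘(ℝ, Base n × VelFibre k n) (extChartAt (modelT k n) x₀)
    ((extChartAt (modelT k n) x₀).symm y) z : Base n × VelFibre k n) = w := h1
  have h3 := tanCoord_dproj hx z
  rw [h2] at h3
  have h4 := dfun_apply hx hd (verticalLift α _ (dproj _ z))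
  rw [mfderiv_chart_verticalLift hx, h3, hyy] at h4
  exact h4

end LocalExpressions

/-! ### Points over the centre of a chart, where tangent vectors are their own coordinates. -/

section BasePoint

variable {k n : ℕ} {Q : Type*} [TopologicalSpace Q] [ChartedSpace (EuclideanSpace ℝ (Fin n)) Q]
  [IsManifold (𝓡 n) ∞ Q]

/-- At the points over the centre of the chart the tangent vectors are represented in this
chart. -/
theorem mfderiv_apply_of_proj_eq {E : Type*} [NormedAddCommGroup E] [NormedSpace ℝ E]
    {f : KTangent k n Q → E} {x₀ x : KTangent k n Q} (h : x.proj = x₀.proj)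
    (hf : MDifferentiableAt (modelT k n) 𝓘(ℝ, E) f x) (w : Base n × VelFibre k n) :
    (mfderiv (modelT k n) 𝓘(ℝ, E) f x : Base n × VelFibre k n →L[ℝ] E) w =
      fderiv ℝ (fun y => f ((extChartAt (modelT k n) x₀).symm y)) (extChartAt (modelT k n) x₀ x)
        w := by
  rw [hf.mfderiv, ModelWithCorners.range_eq_univ, fderivWithin_univ, extChartAt_congr h]
  have : writtenInExtChartAt (modelT k n) 𝓘(ℝ, E) x f =
      fun y => f ((extChartAt (modelT k n) x₀).symm y) := by
    rw [← extChartAt_congr h]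
    rfl
  rw [this]
  rfl

theorem mem_source_of_proj_eq {x₀ x : KTangent k n Q} (h : x.proj = x₀.proj) :
    x ∈ (extChartAt (modelT k n) x₀).source := by
  rw [mem_extChartAt_source_iff, h]
  exact mem_chart_source _ _

theorem mfderiv_chart_self (x : KTangent k n Q) (w : Base n × VelFibre k n) :
    (mfderiv (modelT k n) 𝓘(ℝ, Base n × VelFibre k n) (extChartAt (modelT k n) x) x :
      Base n × VelFibre k n →L[ℝ] Base n × VelFibre k n) w = w := by
  rw [mfderiv_apply_of_proj_eq (x₀ := x) rfl (mdifferentiableAt_chart (mem_extChartAt_source x))]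
  have h : (fun y => extChartAt (modelT k n) x ((extChartAt (modelT k n) x).symm y)) =ᶠ[
      𝓝 (extChartAt (modelT k n) x x)] id := by
    filter_upwards [extChartAt_target_mem_nhds x] with y hy
    exact (extChartAt (modelT k n) x).right_inv hy
  rw [h.fderiv_eq, fderiv_id]
  rfl

theorem dproj_apply (x : KTangent k n Q) (w : Base n × VelFibre k n) : dproj x w = w.1 := by
  have h1 := tanCoord_dproj (mem_extChartAt_source x) w
  have h2 := mfderiv_chart_self x w
  rw [tanCoord_self] at h1
  exact h1.trans (congrArg Prod.fst h2)

theorem velocity_eq {x₀ x : KTangent k n Q} (h : x.proj = x₀.proj) (α : Fin k) :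
    velocity x α = component α (extChartAt (modelT k n) x₀ x).2 := by
  rw [← extChartAt_congr h, extChartAt_apply_self]
  rfl

theorem dfun_apply_of_proj_eq {f : KTangent k n Q → ℝ} {x₀ x : KTangent k n Q}
    (h : x.proj = x₀.proj) (hf : MDifferentiableAt (modelT k n) 𝓘(ℝ, ℝ) f x)
    (w : Base n × VelFibre k n) :
    dfun f x w = fderiv ℝ (inChart x₀ f) (extChartAt (modelT k n) x₀ x) w :=
  mfderiv_apply_of_proj_eq h hf w

variable {L : KTangent k n Q → ℝ}

theorem contMDiff_energy (hL : ContMDiff (modelT k n) 𝓘(ℝ, ℝ) ∞ L) :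
    ContMDiff (modelT k n) 𝓘(ℝ, ℝ) ∞ (energy L) := by
  intro x
  have h1 : energy L =ᶠ[𝓝 x] energyLoc (inChart x L) ∘ extChartAt (modelT k n) x := by
    filter_upwards [extChartAt_source_mem_nhds (I := modelT k n) x] with z hz
    exact energy_eq hL hz
  have h2 := contDiffAt_inChart hL (mem_extChartAt_target (I := modelT k n) x)
  have h3 : ContDiffAt ℝ ∞ (energyLoc (inChart x L)) (extChartAt (modelT k n) x x) :=
    ((h2.fderiv_right (m := ∞) (by simp)).clm_apply (contDiffAt_const.prodMk contDiffAt_snd)).sub h2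
  exact (h3.contMDiffAt.comp x contMDiffAt_extChartAt).congr_of_eventuallyEq h1

theorem contMDiff_dfun_apply {f : KTangent k n Q → ℝ}
    (hf : ContMDiff (modelT k n) 𝓘(ℝ, ℝ) ∞ f) {Z : ∀ x : KTangent k n Q, Tan x}
    (hZ : IsSmoothVF Z) : ContMDiff (modelT k n) 𝓘(ℝ, ℝ) ∞ (fun x => dfun f x (Z x)) := by
  have h1 := hf.contMDiff_tangentMap (m := ∞) (by simp)
  have h2 := (contMDiff_snd_tangentBundle_modelSpace ℝ 𝓘(ℝ, ℝ) (n := ∞)).comp (h1.comp hZ)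
  exact h2

theorem dfun_energy_apply (hL : ContMDiff (modelT k n) 𝓘(ℝ, ℝ) ∞ L) {x₀ x : KTangent k n Q}
    (h : x.proj = x₀.proj) (w : Base n × VelFibre k n) :
    dfun (energy L) x w =
      fderiv ℝ (energyLoc (inChart x₀ L)) (extChartAt (modelT k n) x₀ x) w := by
  rw [dfun_apply_of_proj_eq h ((contMDiff_energy hL).mdifferentiableAt (by simp))]
  have h1 : inChart x₀ (energy L) =ᶠ[𝓝 (extChartAt (modelT k n) x₀ x)]
      energyLoc (inChart x₀ L) := by
    filter_upwards [extChartAt_target_mem_nhds'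
      ((extChartAt (modelT k n) x₀).map_source (mem_source_of_proj_eq h))] with y hy
    rw [inChart, energy_eq hL ((extChartAt (modelT k n) x₀).map_target hy),
      (extChartAt (modelT k n) x₀).right_inv hy]
  rw [h1.fderiv_eq]

/-- Differentiate θ^α = (∂l/∂v_α) dq. The fixed chart at `x₀` serves for every `x` over the same
base point, so both ends of the path in the fibre share one coordinate formula. -/
theorem cartanTwo_apply (hL : ContMDiff (modelT k n) 𝓘(ℝ, ℝ) ∞ L) {x₀ x : KTangent k n Q}
    (h : x.proj = x₀.proj) (α : Fin k) (u w : Base n × VelFibre k n) :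
    cartanTwo L α x u w =
      fderiv ℝ (fderiv ℝ (inChart x₀ L)) (extChartAt (modelT k n) x₀ x) w (0, slot α u.1) -
      fderiv ℝ (fderiv ℝ (inChart x₀ L)) (extChartAt (modelT k n) x₀ x) u (0, slot α w.1) := by
  have hy := (extChartAt (modelT k n) x₀).map_source (mem_source_of_proj_eq h)
  let S : Base n × VelFibre k n →L[ℝ] Base n × VelFibre k n :=
    (ContinuousLinearMap.inr ℝ (Base n) (VelFibre k n)).comp
      ((slot α).comp (ContinuousLinearMap.fst ℝ (Base n) (VelFibre k n)))
  let θ : Base n × VelFibre k n → (Base n × VelFibre k n →L[ℝ] ℝ) := fun y =>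
    (cartanOne L α ((extChartAt (modelT k n) x₀).symm y)).comp
      (mfderivWithin 𝓘(ℝ, Base n × VelFibre k n) (modelT k n) (extChartAt (modelT k n) x₀).symm
        (Set.range (modelT k n)) y)
  have h1 : θ =ᶠ[𝓝 (extChartAt (modelT k n) x₀ x)]
      fun y => (fderiv ℝ (inChart x₀ L) y).comp S := by
    filter_upwards [extChartAt_target_mem_nhds' hy] with y hy
    refine ContinuousLinearMap.ext fun w => ?_
    exact cartanOne_eq hL hy α w
  have h2 : ∀ a b, fderivWithin ℝ θ (Set.range (modelT k n)) (extChartAt (modelT k n) x₀ x) a b =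
      fderiv ℝ (fderiv ℝ (inChart x₀ L)) (extChartAt (modelT k n) x₀ x) a (0, slot α b.1) := by
    intro a b
    have h3 := (hasFDerivAt_fderiv (contDiffAt_inChart hL hy)).clm_comp
      (hasFDerivAt_const S (extChartAt (modelT k n) x₀ x))
    rw [ModelWithCorners.range_eq_univ, fderivWithin_univ, h1.fderiv_eq, h3.fderiv]
    simp [S]
  have h4 : cartanTwo L α x u w =
      -(fderivWithin ℝ θ (Set.range (modelT k n)) (extChartAt (modelT k n) x₀ x) u w -
        fderivWithin ℝ θ (Set.range (modelT k n)) (extChartAt (modelT k n) x₀ x) w u) := by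
    simp only [cartanTwo, extDerivOneForm, θ]
    rw [extChartAt_congr h]
  rw [h4, h2, h2, neg_sub]

theorem bigOmega_apply (hL : ContMDiff (modelT k n) 𝓘(ℝ, ℝ) ∞ L) {x₀ x : KTangent k n Q}
    (h : x.proj = x₀.proj) (X : Fin k → Base n × VelFibre k n) (w : Base n × VelFibre k n) :
    bigOmega L x X w =
      omegaLoc slot (inChart x₀ L) (extChartAt (modelT k n) x₀ x) X w := by
  have hy := (extChartAt (modelT k n) x₀).map_source (mem_source_of_proj_eq h)
  refine Finset.sum_congr rfl fun α _ => ?_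
  rw [fderiv_legLoc (contDiffAt_inChart hL hy), fderiv_legLoc (contDiffAt_inChart hL hy)]
  exact cartanTwo_apply hL h α (X α) w

end BasePoint

/-! ### The fibres of an almost-regular Legendre transformation on the manifold. -/

section Fibre

variable {k n : ℕ} {Q : Type*} [TopologicalSpace Q] [ChartedSpace (EuclideanSpace ℝ (Fin n)) Q]
  [IsManifold (𝓡 n) ∞ Q]

theorem contDiffAt_change_of_chart {p₀ : KCotangent k n Q}
    {e : OpenPartialHomeomorph (KCotangent k n Q) (ModelProd (Base n) (MomFibre k n))}
    (he : e ∈ IsManifold.maximalAtlas (modelC k n) ∞ (KCotangent k n Q))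
    {p : Base n × MomFibre k n} (hp : p ∈ (extChartAt (modelC k n) p₀).target)
    (hpe : (extChartAt (modelC k n) p₀).symm p ∈ e.source) :
    ContDiffAt ℝ ∞ (fun p => e.extend (modelC k n) ((extChartAt (modelC k n) p₀).symm p)) p :=
  ContMDiffAt.contDiffAt (ContMDiffAt.comp p (e.contMDiffAt_extend he hpe)
    ((contMDiffOn_extChartAt_symm (n := ∞) p₀).contMDiffAt (extChartAt_target_mem_nhds' hp)))

theorem contDiffAt_change_of_chart_symm {p₀ : KCotangent k n Q}
    {e : OpenPartialHomeomorph (KCotangent k n Q) (ModelProd (Base n) (MomFibre k n))}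
    (he : e ∈ IsManifold.maximalAtlas (modelC k n) ∞ (KCotangent k n Q)) (hp : p₀ ∈ e.source) :
    ContDiffAt ℝ ∞ (fun r => extChartAt (modelC k n) p₀ ((e.extend (modelC k n)).symm r))
      (e.extend (modelC k n) p₀) := by
  have hnhds : (modelC k n) '' e.target ∈ 𝓝 (e.extend (modelC k n) p₀) := by
    have := e.extend_image_target_mem_nhds (I := modelC k n) hp
    rwa [ModelWithCorners.range_eq_univ, nhdsWithin_univ] at this
  have h1 := (contMDiffOn_extend_symm he).contMDiffAt hnhds
  have h2 : (e.extend (modelC k n)).symm (e.extend (modelC k n) p₀) = p₀ :=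
    e.extend_left_inv hp
  have h3 : ContMDiffAt (modelC k n) 𝓘(ℝ, Base n × MomFibre k n) ∞ (extChartAt (modelC k n) p₀)
      ((e.extend (modelC k n)).symm (e.extend (modelC k n) p₀)) := by
    rw [h2]; exact contMDiffAt_extChartAt
  exact (ContMDiffAt.comp _ h3 h1).contDiffAt

theorem mfderiv_apply_of_eq_comp {E : Type*} [NormedAddCommGroup E] [NormedSpace ℝ E]
    {f : KTangent k n Q → E} {g : Base n × VelFibre k n → E} {x₀ x : KTangent k n Q}
    (h : x.proj = x₀.proj)
    (hfg : ∀ z ∈ (extChartAt (modelT k n) x₀).source, f z = g (extChartAt (modelT k n) x₀ z))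
    (hg : DifferentiableAt ℝ g (extChartAt (modelT k n) x₀ x)) (w : Base n × VelFibre k n) :
    (mfderiv (modelT k n) 𝓘(ℝ, E) f x : Base n × VelFibre k n →L[ℝ] E) w =
      fderiv ℝ g (extChartAt (modelT k n) x₀ x) w := by
  have hx := mem_source_of_proj_eq h
  have hf : MDifferentiableAt (modelT k n) 𝓘(ℝ, E) f x := by
    refine (hg.mdifferentiableAt.comp x (mdifferentiableAt_chart hx)).congr_of_eventuallyEq ?_
    filter_upwards [extChartAt_source_mem_nhds' hx] with z hz using hfg z hz
  rw [mfderiv_apply_of_proj_eq h hf]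
  have h1 : (fun y => f ((extChartAt (modelT k n) x₀).symm y)) =ᶠ[
      𝓝 (extChartAt (modelT k n) x₀ x)] g := by
    filter_upwards [extChartAt_target_mem_nhds' ((extChartAt (modelT k n) x₀).map_source hx)]
      with y hy
    rw [hfg _ ((extChartAt (modelT k n) x₀).map_target hy),
      (extChartAt (modelT k n) x₀).right_inv hy]
  rw [h1.fderiv_eq]

variable {L : KTangent k n Q → ℝ} {x₀ : KTangent k n Q}

/-- The base chart is injective. Thus changing only the fibre coordinate stays over the same base
point, which keeps the base-point formulas applicable along the path. -/
theorem proj_symm_eq {y : Base n × VelFibre k n} (hy : y ∈ (extChartAt (modelT k n) x₀).target)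
    (h : y.1 = (extChartAt (modelT k n) x₀ x₀).1) :
    ((extChartAt (modelT k n) x₀).symm y).proj = x₀.proj := by
  have h1 := (extChartAt (modelT k n) x₀).right_inv hy
  have h2 := (mem_extChartAt_source_iff _ _).1 ((extChartAt (modelT k n) x₀).map_target hy)
  rw [extChartAt_apply] at h1
  rw [extChartAt_apply] at h
  refine (extChartAt (𝓡 n) x₀.proj).injOn (by rwa [extChartAt_source])
    (mem_extChartAt_source x₀.proj) ?_
  exact (congrArg Prod.fst h1).trans h

theorem legendre_symm (hL : ContMDiff (modelT k n) 𝓘(ℝ, ℝ) ∞ L) {y : Base n × VelFibre k n}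
    (hy : y ∈ (extChartAt (modelT k n) x₀).target) :
    legendre L ((extChartAt (modelT k n) x₀).symm y) =
      (extChartAt (modelC k n) (legendre L x₀)).symm (legLoc slot (inChart x₀ L) y) := by
  have hx := (extChartAt (modelT k n) x₀).map_target hy
  have h1 := extChartAt_legendre hL hx
  rw [(extChartAt (modelT k n) x₀).right_inv hy] at h1
  rw [← h1, (extChartAt (modelC k n) (legendre L x₀)).left_inv]
  rw [mem_extChartAt_source_iff_cotangent]
  exact (mem_extChartAt_source_iff _ _).1 hx

theorem legLoc_chart (hL : ContMDiff (modelT k n) 𝓘(ℝ, ℝ) ∞ L) (x₀ : KTangent k n Q) :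
    legLoc slot (inChart x₀ L) (extChartAt (modelT k n) x₀ x₀) =
      extChartAt (modelC k n) (legendre L x₀) (legendre L x₀) :=
  (extChartAt_legendre hL (mem_extChartAt_source x₀)).symm

set_option maxHeartbeats 1000000 in
/-- Moving from `x₀` in a direction of the kernel of the vertical Hessian, one stays in the fibre
of an almost-regular Legendre transformation, and its infinitesimal data do not change. -/
theorem eventually_legendre_fibre (hL : IsAlmostRegular L) {a : VelFibre k n}
    (ha : fderiv ℝ (legLoc slot (inChart x₀ L)) (extChartAt (modelT k n) x₀ x₀) (0, a) = 0) :
    ∀ᶠ t in 𝓝 (0 : ℝ),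
      legLoc slot (inChart x₀ L) (extChartAt (modelT k n) x₀ x₀ + t • (0, a)) =
        legLoc slot (inChart x₀ L) (extChartAt (modelT k n) x₀ x₀) ∧
      (∀ w, ∃ w', fderiv ℝ (legLoc slot (inChart x₀ L))
          (extChartAt (modelT k n) x₀ x₀ + t • (0, a)) w' =
        fderiv ℝ (legLoc slot (inChart x₀ L)) (extChartAt (modelT k n) x₀ x₀) w) ∧
      (∀ w', ∃ w, fderiv ℝ (legLoc slot (inChart x₀ L))
          (extChartAt (modelT k n) x₀ x₀ + t • (0, a)) w' =
        fderiv ℝ (legLoc slot (inChart x₀ L)) (extChartAt (modelT k n) x₀ x₀) w) ∧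
      (∀ w w', fderiv ℝ (legLoc slot (inChart x₀ L))
          (extChartAt (modelT k n) x₀ x₀ + t • (0, a)) w' =
        fderiv ℝ (legLoc slot (inChart x₀ L)) (extChartAt (modelT k n) x₀ x₀) w →
        fderiv ℝ (energyLoc (inChart x₀ L)) (extChartAt (modelT k n) x₀ x₀ + t • (0, a)) w' =
        fderiv ℝ (energyLoc (inChart x₀ L)) (extChartAt (modelT k n) x₀ x₀) w) ∧
      ∀ (f : Base n × VelFibre k n → ℝ) (h : Base n × MomFibre k n → ℝ),
        DifferentiableAt ℝ f (extChartAt (modelT k n) x₀ x₀) →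
        DifferentiableAt ℝ f (extChartAt (modelT k n) x₀ x₀ + t • (0, a)) →
        (∀ᶠ z in 𝓝 (extChartAt (modelT k n) x₀ x₀),
          f z = h (legLoc slot (inChart x₀ L) z)) →
        (∀ᶠ z in 𝓝 (extChartAt (modelT k n) x₀ x₀ + t • (0, a)),
          f z = h (legLoc slot (inChart x₀ L) z)) →
        ∀ w w', fderiv ℝ (legLoc slot (inChart x₀ L))
            (extChartAt (modelT k n) x₀ x₀ + t • (0, a)) w' =
          fderiv ℝ (legLoc slot (inChart x₀ L)) (extChartAt (modelT k n) x₀ x₀) w →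
          fderiv ℝ f (extChartAt (modelT k n) x₀ x₀ + t • (0, a)) w' =
          fderiv ℝ f (extChartAt (modelT k n) x₀ x₀) w := by
  have hs := hL.smooth
  obtain ⟨e, F, hslice⟩ := hL.image_submanifold (legendre L x₀) ⟨x₀, rfl⟩
  obtain ⟨he, hpe, hS⟩ := hslice
  have hy₀ := mem_extChartAt_target (I := modelT k n) x₀
  have htar := extChartAt_target_mem_nhds (I := modelT k n) x₀
  have hleg₀ := legLoc_chart hs x₀
  have hlegc : ContinuousAt (legLoc slot (inChart x₀ L)) (extChartAt (modelT k n) x₀ x₀) :=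
    (contDiffAt_legLoc (contDiffAt_inChart hs hy₀)).continuousAt
  have hΨ : ∀ᶠ p in 𝓝 (legLoc slot (inChart x₀ L) (extChartAt (modelT k n) x₀ x₀)),
      p ∈ (extChartAt (modelC k n) (legendre L x₀)).target ∧
        (extChartAt (modelC k n) (legendre L x₀)).symm p ∈ e.source := by
    rw [hleg₀]
    have h1 : e.source ∈ 𝓝 ((extChartAt (modelC k n) (legendre L x₀)).symm
        (extChartAt (modelC k n) (legendre L x₀) (legendre L x₀))) := by
      rw [extChartAt_to_inv]
      exact e.open_source.mem_nhds hpe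
    filter_upwards [extChartAt_target_mem_nhds (I := modelC k n) (legendre L x₀),
      (continuousAt_extChartAt_symm (I := modelC k n) (legendre L x₀)).preimage_mem_nhds h1]
      with p hp1 hp2 using ⟨hp1, hp2⟩
  obtain ⟨κ, hκ⟩ : ∃ κ : Base n × MomFibre k n → Base n × MomFibre k n, κ = fun p =>
      e.extend (modelC k n) ((extChartAt (modelC k n) (legendre L x₀)).symm p) := ⟨_, rfl⟩
  have hκc : ∀ p, p ∈ (extChartAt (modelC k n) (legendre L x₀)).target ∧
      (extChartAt (modelC k n) (legendre L x₀)).symm p ∈ e.source → ContDiffAt ℝ ∞ κ p := by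
    rintro p ⟨h1, h2⟩
    rw [hκ]
    exact contDiffAt_change_of_chart he h1 h2
  have hG : ∀ y ∈ (extChartAt (modelT k n) x₀).target,
      e.extend (modelC k n) (legendre L ((extChartAt (modelT k n) x₀).symm y)) =
      κ (legLoc slot (inChart x₀ L) y) := fun y hy => by rw [legendre_symm hs hy, hκ]
  have hx₀ : (extChartAt (modelT k n) x₀).symm (extChartAt (modelT k n) x₀ x₀) = x₀ :=
    extChartAt_to_inv x₀
  refine eventually_legLoc_fibre (c := component) sum_slot
    (κ := κ)
    (κ' := fun r => extChartAt (modelC k n) (legendre L x₀) ((e.extend (modelC k n)).symm r))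
    (F := F) ?_ ?_ ?_ ?_ ?_ ?_ ha
  · filter_upwards [htar] with y hy using contDiffAt_inChart hs hy
  · filter_upwards [hΨ] with p hp
    exact (hκc p hp).of_le (by norm_cast)
  · simp only [hκ]
    rw [hleg₀, extChartAt_to_inv]
    exact (contDiffAt_change_of_chart_symm he hpe).differentiableAt (by simp)
  · filter_upwards [hΨ] with p hp
    simp only [hκ]
    rw [e.extend_left_inv hp.2, (extChartAt (modelC k n) (legendre L x₀)).right_inv hp.1]
  · filter_upwards [htar, hlegc.eventually hΨ] with y hy hp
    rw [← hG y hy, ← hG _ hy₀, hx₀]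
    refine (hS _ ?_).1 ⟨_, rfl⟩
    rw [legendre_symm hs hy]
    exact hp.2
  · filter_upwards [htar, hlegc.eventually hΨ] with y hy hp hyleg
    have hy1 : (legLoc slot (inChart x₀ L) y).1 =
        (legLoc slot (inChart x₀ L) (extChartAt (modelT k n) x₀ x₀)).1 := congrArg Prod.fst hyleg
    have hproj : ((extChartAt (modelT k n) x₀).symm y).proj = x₀.proj := proj_symm_eq hy hy1
    have hlegx : legendre L ((extChartAt (modelT k n) x₀).symm y) = legendre L x₀ := by
      rw [legendre_symm hs hy, hyleg, ← legendre_symm hs hy₀, hx₀]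
    have hyy := (extChartAt (modelT k n) x₀).right_inv hy
    -- The slice chart chosen at the image of `x₀` also serves at this point, because it has the
    -- same image; hence the ranges of the derivative in this chart agree, both being F.
    have hsub := hL.submersion ((extChartAt (modelT k n) x₀).symm y) e F
      (by rw [hlegx]; exact ⟨he, hpe, hS⟩)
    have hκd : DifferentiableAt ℝ (fun z : Base n × VelFibre k n => κ (legLoc slot (inChart x₀ L) z)) y :=
      differentiableAt_comp_legLoc (contDiffAt_inChart hs hy) (hκc _ hp)
    have hder := mfderiv_apply_of_eq_comp hproj
      (f := fun z => e.extend (modelC k n) (legendre L z))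
      (g := fun z : Base n × VelFibre k n => κ (legLoc slot (inChart x₀ L) z)) (fun z hz => by
        have h2 := hG _ ((extChartAt (modelT k n) x₀).map_source hz)
        rw [(extChartAt (modelT k n) x₀).left_inv hz] at h2
        exact h2) (by rw [hyy]; exact hκd)
    rw [hyy] at hder
    rw [← hsub]
    exact congrArg Set.range (funext fun w => (hder w).symm)

end Fibre

/-! ### Dependence of Ω on the derivative of the Legendre map. -/

section Algebra

variable {k : ℕ} {B V : Type*} [NormedAddCommGroup B] [NormedSpace ℝ B] [FiniteDimensional ℝ B]
  [NormedAddCommGroup V] [NormedSpace ℝ V] [FiniteDimensional ℝ V]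
  {s : Fin k → B →L[ℝ] V} {l : B × V → ℝ} {x y : B × V}

theorem omegaLoc_add_smul (X Y : Fin k → B × V) (t : ℝ) (w : B × V) :
    omegaLoc s l y (fun α => X α + t • Y α) w = omegaLoc s l y X w + t * omegaLoc s l y Y w := by
  simp only [omegaLoc, Finset.mul_sum, ← Finset.sum_add_distrib]
  refine Finset.sum_congr rfl fun α _ => ?_
  simp
  ring

theorem fst_eq_of_fderiv_legLoc_eq (hx : ContDiffAt ℝ ∞ l x) (hy : ContDiffAt ℝ ∞ l y)
    {u w : B × V} (h : fderiv ℝ (legLoc s l) y u = fderiv ℝ (legLoc s l) x w) : u.1 = w.1 := by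
  have := congrArg Prod.fst h
  rwa [fderiv_legLoc hx, fderiv_legLoc hy] at this

/-- Both the momentum parts and the base components entering Ω are read off from the derivative of
the Legendre map, so the point itself plays no other role. -/
theorem omegaLoc_congr (hx : ContDiffAt ℝ ∞ l x) (hy : ContDiffAt ℝ ∞ l y)
    {X Y : Fin k → B × V} {u w : B × V}
    (hXY : ∀ α, fderiv ℝ (legLoc s l) y (Y α) = fderiv ℝ (legLoc s l) x (X α))
    (huw : fderiv ℝ (legLoc s l) y u = fderiv ℝ (legLoc s l) x w) :
    omegaLoc s l y Y u = omegaLoc s l x X w := by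
  refine Finset.sum_congr rfl fun α _ => ?_
  rw [hXY, huw, fst_eq_of_fderiv_legLoc_eq hx hy (hXY α), fst_eq_of_fderiv_legLoc_eq hx hy huw]

end Algebra

/-! ### Comparison of η₂ at two points of a fibre. -/

section Main

variable {k n : ℕ} {Q : Type*} [TopologicalSpace Q] [ChartedSpace (EuclideanSpace ℝ (Fin n)) Q]
  [IsManifold (𝓡 n) ∞ Q]

theorem tangency_apply {L : KTangent k n Q → ℝ} {Z : Fin k → ∀ x : KTangent k n Q, Tan x}
    (hζ : ∀ α, ContMDiff (modelT k n) 𝓘(ℝ, ℝ) ∞ (zeta1 L (Z α))) {x₀ x : KTangent k n Q}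
    (h : x.proj = x₀.proj) (W : Fin k → Base n × VelFibre k n) :
    tangency L Z x W = ∑ α, fderiv ℝ (inChart x₀ (zeta1 L (Z α)))
      (extChartAt (modelT k n) x₀ x) (W α) :=
  Finset.sum_congr rfl fun α _ =>
    dfun_apply_of_proj_eq h ((hζ α).mdifferentiableAt (by simp)) (W α)

theorem tangency_add_smul {L : KTangent k n Q → ℝ} {Z : Fin k → ∀ x : KTangent k n Q, Tan x}
    {x : KTangent k n Q} (U W : Fin k → Tan x) (t : ℝ) :
    tangency L Z x (fun α => U α + t • W α) = tangency L Z x U + t * tangency L Z x W := by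
  simp only [tangency, Finset.mul_sum, ← Finset.sum_add_distrib]
  refine Finset.sum_congr rfl fun α _ => ?_
  exact ((dfun (zeta1 L (Z α)) x).map_add _ _).trans
    (congrArg _ ((dfun (zeta1 L (Z α)) x).map_smul t _))

theorem bigOmega_add {L : KTangent k n Q → ℝ} (hL : ContMDiff (modelT k n) 𝓘(ℝ, ℝ) ∞ L)
    {x : KTangent k n Q} (U W : Fin k → Tan x) (w : Tan x) :
    bigOmega L x (U + W) w = bigOmega L x U w + bigOmega L x W w := by
  have h : ∀ (U W : Fin k → Base n × VelFibre k n) (w : Base n × VelFibre k n),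
      omegaLoc slot (inChart x L) (extChartAt (modelT k n) x x) (fun α => U α + W α) w =
      omegaLoc slot (inChart x L) (extChartAt (modelT k n) x x) U w +
        omegaLoc slot (inChart x L) (extChartAt (modelT k n) x x) W w := fun U W w => by
    simpa only [one_smul, one_mul] using omegaLoc_add_smul U W 1 w
  have h1 := bigOmega_apply hL (x := x) rfl (fun α => U α + W α) w
  have h2 := bigOmega_apply hL (x := x) rfl U w
  have h3 := bigOmega_apply hL (x := x) rfl W w
  exact h1.trans ((h U W w).trans (congrArg₂ (· + ·) h2.symm h3.symm))

set_option maxHeartbeats 2000000 in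
/-- A second generation SOPDE constraint takes different values on a fibre of the Legendre
transformation. -/
theorem exists_fibre_eta2_ne (L : KTangent k n Q → ℝ) (hL : IsAlmostRegular L)
    (X Y V : ∀ x : KTangent k n Q, Fin k → Tan x)
    (hX : ∀ x ∈ P1 L, SolvesLagrangian L x (X x)) (hY : ∀ x ∈ S1 L, InKerOmega L x (Y x))
    (hV : ∀ x ∈ S1 L, InVertKerOmega L x (V x))
    (hsopde : ∀ x ∈ S1 L, IsSopdeAt x (X x + Y x + V x))
    (Z : Fin k → ∀ x : KTangent k n Q, Tan x) (hZ : ∀ α, IsSmoothVF (Z α))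
    (hproj : ∀ α, IsFLProjectable L (zeta1 L (Z α)))
    (x₀ : KTangent k n Q) (hx₀ : x₀ ∈ S1 L)
    (hconstraint : ∀ U : Fin k → Tan x₀, InVertKerOmega L x₀ U → tangency L Z x₀ U = 0)
    (hYne : tangency L Z x₀ (Y x₀) ≠ 0) :
    ∃ x ∈ S1 L, legendre L x = legendre L x₀ ∧ eta2 L X Y V Z x ≠ eta2 L X Y V Z x₀ := by
  have hs := hL.smooth
  have hζ : ∀ α, ContMDiff (modelT k n) 𝓘(ℝ, ℝ) ∞ (zeta1 L (Z α)) := fun α =>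
    contMDiff_dfun_apply (contMDiff_energy hs) (hZ α)
  have hP1 : S1 L ⊆ P1 L := fun x ⟨U, hU, _⟩ => ⟨U, hU⟩
  have hsolve : ∀ x ∈ S1 L, SolvesLagrangian L x (X x + Y x + V x) := fun x hx w => by
    rw [bigOmega_add hs, bigOmega_add hs, hX x (hP1 hx), hY x hx, (hV x hx).1, add_zero, add_zero]
  obtain ⟨l, hl⟩ : ∃ l, l = inChart x₀ L := ⟨_, rfl⟩
  obtain ⟨y₀, hy₀⟩ : ∃ y₀, y₀ = extChartAt (modelT k n) x₀ x₀ := ⟨_, rfl⟩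
  let Y₀ : Fin k → Base n × VelFibre k n := Y x₀
  let W₀ : Fin k → Base n × VelFibre k n := X x₀ + Y x₀ + V x₀
  -- The base components of Y assembled into one vertical direction: moving by t a changes the
  -- velocities exactly as adding tY changes the base components of a k-vector.
  let a : VelFibre k n := ∑ α, slot α (Y₀ α).1
  have hl₀ : ContDiffAt ℝ ∞ l y₀ := by
    rw [hl, hy₀]; exact contDiffAt_inChart hs (mem_extChartAt_target x₀)
  have hΩ₀ : ∀ (U : Fin k → Base n × VelFibre k n) (w : Base n × VelFibre k n),
      bigOmega L x₀ U w = omegaLoc slot l y₀ U w :=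
    fun U w => by rw [hl, hy₀]; exact bigOmega_apply hs rfl U w
  have hE₀ : ∀ w : Base n × VelFibre k n, dfun (energy L) x₀ w = fderiv ℝ (energyLoc l) y₀ w :=
    fun w => by rw [hl, hy₀]; exact dfun_energy_apply hs rfl w
  have hW₀ : ∀ w, omegaLoc slot l y₀ W₀ w = fderiv ℝ (energyLoc l) y₀ w := fun w => by
    rw [← hΩ₀, ← hE₀]; exact hsolve x₀ hx₀ w
  have hY₀ : ∀ w, omegaLoc slot l y₀ Y₀ w = 0 := fun w => by
    rw [← hΩ₀]; exact hY x₀ hx₀ w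
  have hvel₀ : ∀ α, (W₀ α).1 = component α y₀.2 := fun α => by
    rw [hy₀, ← velocity_eq rfl, ← hsopde x₀ hx₀ α]
    exact (dproj_apply x₀ (W₀ α)).symm
  have ha : fderiv ℝ (legLoc slot l) y₀ (0, a) = 0 :=
    fderiv_legLoc_of_omegaLoc_eq_zero sum_slot hl₀ hY₀
  have hev := eventually_legendre_fibre (x₀ := x₀) hL (a := a) (by rw [← hl, ← hy₀]; exact ha)
  rw [← hl, ← hy₀] at hev
  have htar : ∀ᶠ t in 𝓝 (0 : ℝ), y₀ + t • (0, a) ∈ (extChartAt (modelT k n) x₀).target := by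
    refine (tendsto_add_smul y₀ ((0, a) : Base n × VelFibre k n)).eventually_mem ?_
    rw [hy₀]
    exact extChartAt_target_mem_nhds x₀
  -- Any sufficiently small t ≠ 0 will do; t ≠ 0 is what finally separates the two values of η₂.
  obtain ⟨t, ⟨⟨hleg, hlift, hdrop, hen, hfun⟩, hyt⟩, ht⟩ :=
    (((hev.and htar).filter_mono nhdsWithin_le_nhds).and
      (self_mem_nhdsWithin : {(0 : ℝ)}ᶜ ∈ 𝓝[≠] (0 : ℝ))).exists
  obtain ⟨y, hy⟩ : ∃ y, y = y₀ + t • ((0, a) : Base n × VelFibre k n) := ⟨_, rfl⟩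
  rw [← hy] at hleg hlift hdrop hen hfun hyt
  obtain ⟨x, hx⟩ : ∃ x, x = (extChartAt (modelT k n) x₀).symm y := ⟨_, rfl⟩
  have hxy : extChartAt (modelT k n) x₀ x = y := by
    rw [hx]; exact (extChartAt (modelT k n) x₀).right_inv hyt
  have hp : x.proj = x₀.proj := by
    rw [hx]; exact proj_symm_eq hyt (by rw [hy, hy₀]; simp)
  have hly : ContDiffAt ℝ ∞ l y := by rw [hl]; exact contDiffAt_inChart hs hyt
  have hΩ : ∀ (U : Fin k → Base n × VelFibre k n) (w : Base n × VelFibre k n),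
      bigOmega L x U w = omegaLoc slot l y U w :=
    fun U w => by rw [hl, ← hxy]; exact bigOmega_apply hs hp U w
  have hE : ∀ w : Base n × VelFibre k n, dfun (energy L) x w = fderiv ℝ (energyLoc l) y w :=
    fun w => by rw [hl, ← hxy]; exact dfun_energy_apply hs hp w
  have hvel : ∀ α, velocity x α = (W₀ α).1 + t • (Y₀ α).1 := fun α => by
    rw [velocity_eq hp, hxy, hy, hvel₀, ← component_sum_slot (fun β => (Y₀ β).1) α]
    simp [a]
    rfl
  have hlegx : legendre L x = legendre L x₀ := by
    rw [hx, legendre_symm hs hyt, ← hl, hleg, hl, hy₀, ← legendre_symm hs (mem_extChartAt_target x₀),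
      extChartAt_to_inv]
  have hxS : x ∈ S1 L := by
    -- The match at `x` of W₀ + tY₀ is already SOPDE, so 0 serves as the correction from Ker Ω.
    choose W hW using fun α => hlift (W₀ α + t • Y₀ α)
    refine ⟨W, fun w => ?_, 0, fun w => ?_, fun α => ?_⟩
    · obtain ⟨w₀, hw₀⟩ := hdrop w
      refine (hΩ W w).trans (Eq.trans ?_ (hE w).symm)
      rw [hen w₀ w hw₀, omegaLoc_congr hl₀ hly hW hw₀, omegaLoc_add_smul, hW₀, hY₀,
        mul_zero, add_zero]
    · exact (hΩ 0 w).trans (by simp [omegaLoc])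
    · refine Eq.trans (congrArg (dproj x) (add_zero (W α : Tan x))) ?_
      exact ((dproj_apply x (W α)).trans (fst_eq_of_fderiv_legLoc_eq hl₀ hly (hW α))).trans
        (hvel α).symm
  refine ⟨x, hxS, hlegx, ?_⟩
  let W : Fin k → Base n × VelFibre k n := X x + Y x + V x
  -- Transport the given SOPDE solution at `x` back to `x₀`, where the hypothesis on vertical kernel
  -- elements is available.
  choose W' hW' using fun α => hdrop (W α)
  have hdζ : ∀ α, fderiv ℝ (inChart x₀ (zeta1 L (Z α))) y (W α) =
      fderiv ℝ (inChart x₀ (zeta1 L (Z α))) y₀ (W' α) := fun α => by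
    obtain ⟨h, hh⟩ := hproj α
    have hfac : ∀ z ∈ (extChartAt (modelT k n) x₀).target, inChart x₀ (zeta1 L (Z α)) z =
        h ((extChartAt (modelC k n) (legendre L x₀)).symm (legLoc slot l z)) := fun z hz => by
      rw [inChart, hh _ (Set.mem_univ _), legendre_symm hs hz, hl]
    refine hfun _ (fun p => h ((extChartAt (modelC k n) (legendre L x₀)).symm p)) ?_ ?_ ?_ ?_ _ _
      (hW' α)
    · rw [hy₀]
      exact (contDiffAt_inChart (hζ α) (mem_extChartAt_target x₀)).differentiableAt (by simp)
    · exact (contDiffAt_inChart (hζ α) hyt).differentiableAt (by simp)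
    · rw [hy₀]
      filter_upwards [extChartAt_target_mem_nhds x₀] with z hz using hfac z hz
    · filter_upwards [extChartAt_target_mem_nhds' hyt] with z hz using hfac z hz
  have h1 : eta2 L X Y V Z x = tangency L Z x₀ W' := by
    rw [tangency_apply hζ (x₀ := x₀) rfl W', ← hy₀]
    have h2 := tangency_apply hζ hp W
    rw [hxy] at h2
    exact h2.trans (Finset.sum_congr rfl fun α _ => hdζ α)
  -- Both `W'` and W₀ + tY₀ solve the Lagrangian equation at `x₀` and have the velocities of `x` as
  -- base components, so their difference is vertical and in Ker Ω.
  let U : Fin k → Base n × VelFibre k n := fun α => W' α + (-1 : ℝ) • (W₀ α + t • Y₀ α)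
  have hU : InVertKerOmega L x₀ U := by
    refine ⟨fun (w : Base n × VelFibre k n) => ?_, fun α => ?_⟩
    · obtain ⟨w', hw'⟩ := hlift w
      have h3 := hsolve x hxS w'
      have h4 : omegaLoc slot l y W w' = fderiv ℝ (energyLoc l) y w' := by
        rw [← hΩ, ← hE]; exact h3
      refine ((hΩ₀ U w).trans
        (omegaLoc_add_smul W' (fun α => W₀ α + t • Y₀ α) (-1) w)).trans ?_
      rw [omegaLoc_add_smul W₀ Y₀, hW₀, hY₀,
        ← omegaLoc_congr hl₀ hly hW' hw', h4, hen _ _ hw']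
      ring
    · refine (dproj_apply x₀ (U α)).trans ?_
      have h3 : (W α).1 = velocity x α :=
        (dproj_apply x (W α)).symm.trans (hsopde x hxS α)
      have h4 : (W' α).1 = (W₀ α).1 + t • (Y₀ α).1 := by
        rw [← fst_eq_of_fderiv_legLoc_eq hl₀ hly (hW' α), h3, hvel]
      change (W' α).1 + (-1 : ℝ) • ((W₀ α).1 + t • (Y₀ α).1) = 0
      rw [h4, neg_one_smul, add_neg_cancel]
  have h5 := hconstraint U hU
  have h6 : tangency L Z x₀ U = tangency L Z x₀ W' + (-1) *
      (tangency L Z x₀ W₀ + t * tangency L Z x₀ Y₀) :=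
    (tangency_add_smul (x := x₀) W' (fun α => W₀ α + t • Y₀ α) (-1)).trans
      (congrArg (fun r => tangency L Z x₀ W' + (-1) * r)
        (tangency_add_smul (x := x₀) W₀ Y₀ t))
  have h7 : eta2 L X Y V Z x₀ = tangency L Z x₀ W₀ := rfl
  have h8 : t * tangency L Z x₀ Y₀ ≠ 0 := mul_ne_zero ht hYne
  rw [h1, h7]
  intro h9
  apply h8
  linarith

end Main

end KSymplectic

end

theorem mainTheorem7 {k n : ℕ} {Q : Type*} [TopologicalSpace Q]
    [ChartedSpace (EuclideanSpace ℝ (Fin n)) Q] [IsManifold (𝓡 n) ∞ Q]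
    (L : KSymplectic.KTangent k n Q → ℝ) (hL : KSymplectic.IsAlmostRegular L)
    (X Y V : ∀ x : KSymplectic.KTangent k n Q, Fin k → KSymplectic.Tan x)
    (hXs : KSymplectic.IsSmoothKVF X) (hYs : KSymplectic.IsSmoothKVF Y)
    (hVs : KSymplectic.IsSmoothKVF V)
    (hX : ∀ x ∈ KSymplectic.P1 L, KSymplectic.SolvesLagrangian L x (X x))
    (hY : ∀ x ∈ KSymplectic.S1 L, KSymplectic.InKerOmega L x (Y x))
    (hV : ∀ x ∈ KSymplectic.S1 L, KSymplectic.InVertKerOmega L x (V x))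
    (hsopde : ∀ x ∈ KSymplectic.S1 L, KSymplectic.IsSopdeAt x (X x + Y x + V x))
    (Z : Fin k → ∀ x : KSymplectic.KTangent k n Q, KSymplectic.Tan x)
    (hZ : ∀ α, KSymplectic.InAnnihilator L (Z α))
    (hproj : ∀ α, KSymplectic.IsFLProjectable L (KSymplectic.zeta1 L (Z α)))
    (x₀ : KSymplectic.KTangent k n Q) (hx₀ : x₀ ∈ KSymplectic.S1 L)
    (hconstraint : ∀ U : Fin k → KSymplectic.Tan x₀, KSymplectic.InVertKerOmega L x₀ U →
      KSymplectic.tangency L Z x₀ U = 0)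
    (hYne : KSymplectic.tangency L Z x₀ (Y x₀) ≠ 0) :
    ¬ KSymplectic.IsFLProjectable L (KSymplectic.eta2 L X Y V Z) ∧
      ¬ KSymplectic.IsFLProjectableOn L (KSymplectic.S1 L) (KSymplectic.eta2 L X Y V Z) := by
  obtain ⟨x, hxS, hleg, hne⟩ := KSymplectic.exists_fibre_eta2_ne L hL X Y V hX hY hV hsopde Z
    (fun α => (hZ α).1) hproj x₀ hx₀ hconstraint hYne
  have h : ¬ KSymplectic.IsFLProjectableOn L (KSymplectic.S1 L)
      (KSymplectic.eta2 L X Y V Z) := by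
    rintro ⟨h, hh⟩
    exact hne (by rw [hh x hxS, hh x₀ hx₀, hleg])
  exact ⟨fun ⟨f, hf⟩ => h ⟨f, fun x _ => hf x (Set.mem_univ x)⟩, h⟩
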